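/- Throughout, $S$ is a (discrete, non-empty) semigroup, not necessarily with an identity. Write $pS=\{ps : s\in S\}$. Let $S^*$ be the group of invertible elements of $S$ (with $S^*=\emptyset$ if $S$ has no identity). Call $S$ *right LCM* if it is left cancellative and, whenever $pS\cap qS\neq\emptyset$, the elements $p,q$ have a right least common multiple, i.e. there is $r\in(\{p\}\cup pS)\cap(\{q\}\cup qS)$ with $pS\cap qS=rS$ (if $S$ has an identity this says just that $pS\cap qS=rS$ for some $r\in S$). Let $\mathcal J(S)$ be the smallest family of subsets of $S$ that contains $\emptyset$ and $S$ and is closed under $X\mapsto pX$ and $X\mapsto p^{-1}X=\{y\in S: py\in X\}$ for $p\in S$; for left cancellative $S$ it is closed under intersections. The full semigroup $C^*$-algebra $C^*(S)$ is the universal unital $C^*$-algebra generated by isometries $(v_p)_{p\in S}$ and projections $(e_X)_{X\in\mathcal J(S)}$ such that, for all $p,q\in S$ and $X,Y\in\mathcal J(S)$, (L1) $v_pv_q=v_{pq}$; (L2) $v_pe_Xv_p^*=e_{pX}$; (L3) $e_\emptyset=0$ and $e_S=1$; (L4) $e_Xe_Y=e_{X\cap Y}$. Its diagonal is $\mathcal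 D=C^*(\{e_X: X\in\mathcal J(S)\})\subseteq C^*(S)$. We say that $\Phi_{\mathcal D}:C^*(S)\to\mathcal D$ is a faithful conditional expectation if there is a conditional expectation $\Phi_{\mathcal D}$ of $C^*(S)$ onto $\mathcal D$, faithful on positive elements, with $\Phi_{\mathcal D}(v_pv_q^*)=v_pv_p^*$ if $p=q$ and $\Phi_{\mathcal D}(v_pv_q^*)=0$ if $p\ne q$; here $p,q$ range over $S$ if $S$ has an identity, and over $\tilde S=S\cup\{1\}$, with $v_1=1$, otherwise. Condition (D2) for $S$ with $S^*\ne\emptyset$ is: if $s_0\in S$, $s_1\in s_0S$ and $F\subset S$ is a finite set with $s_1S\cap\bigl(S\setminus\bigcup_{q\in F}qS\bigr)\neq\emptyset$, then for every $x\in S^*\setminus\{1_S\}$ there is $s_2\in s_1S$ such that $$s_2S\cap\Bigl(S\setminus\bigcup_{q\in F}qS\Bigr)\neq\emptyset\quad\text{and}\quad s_0^{-1}s_2S\cap x\,s_0^{-1}s_2S=\emptyset .$$ **Theorem.** Let $S$ be a cancellative right LCM semigroup such that $\Phi_{\mathcal D}:C^*(S)\to\mathcal D$ is a faithful conditional expectation.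 Let $(V_p)_{p\in S}$ be isometries and $(E_X)_{X\in\mathcal J(S)}$ projections in a unital $C^*$-algebra $B$ satisfying (L1)–(L4), and let $\pi=\pi_{V,E}:C^*(S)\to B$ be the associated unital $*$-homomorphism, $\pi(v_p)=V_p$, $\pi(e_X)=E_X$. Assume that one of the following holds: (1) $|S^*|\le 1$; (2) $|S^*|>1$ and $S$ satisfies (D2). Then $\pi$ is injective if and only if $$\prod_{p\in F}(1-E_{pS})\neq 0\quad\text{for every finite } F\subset S\setminus S^* .$$ -/

import Mathlib

set_option linter.unusedSectionVars false

noncomputable section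

/-! ### Free unital `*`-algebras over `ℂ` -/

/-- The words in the letters `x` and `x⋆`, `x : X`; the letter `(x, true)` is `x⋆`. -/
abbrev StarWord (X : Type*) : Type _ := FreeMonoid (X × Bool)

/-- The adjoint of a word, `(y₁ ⋯ yₙ)⋆ = yₙ⋆ ⋯ y₁⋆`. -/
def StarWord.adj {X : Type*} (w : StarWord X) : StarWord X :=
  star (FreeMonoid.map (fun y : X × Bool => (y.1, !y.2)) w)

theorem StarWord.adj_mul {X : Type*} (w w' : StarWord X) : (w * w').adj = w'.adj * w.adj := by
  simp [StarWord.adj]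

theorem StarWord.adj_adj {X : Type*} (w : StarWord X) : w.adj.adj = w := by
  induction w using FreeMonoid.inductionOn' with
  | one => rfl
  | of_mul y w ih =>
    rw [StarWord.adj_mul, StarWord.adj_mul, ih]
    congr 1
    simp [StarWord.adj]

/-- The free unital `*`-algebra over `ℂ` on the set `X`, with basis the words in `x` and `x⋆`. -/
def FreeStarAlg (X : Type*) : Type _ := MonoidAlgebra ℂ (StarWord X)

namespace FreeStarAlg

variable {X : Type*}

instance instRing : Ring (FreeStarAlg X) := inferInstanceAs (Ring (MonoidAlgebra ℂ (StarWord X)))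

instance instAlgebra : Algebra ℂ (FreeStarAlg X) :=
  inferInstanceAs (Algebra ℂ (MonoidAlgebra ℂ (StarWord X)))

/-- A word, as an element of the free `*`-algebra. -/
def word : StarWord X →* FreeStarAlg X := MonoidAlgebra.of ℂ (StarWord X)

/-- The generator `x`. -/
def gen (x : X) : FreeStarAlg X := word (FreeMonoid.of (x, false))

theorem smul_word (c : ℂ) (w : StarWord X) :
    (c • word w : FreeStarAlg X) = MonoidAlgebra.single w c := by
  change c • (MonoidAlgebra.of ℂ (StarWord X)) w = _
  simp

theorem induction {P : FreeStarAlg X → Prop} (hw : ∀ (c : ℂ) w, P (c • word w))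
    (hadd : ∀ a b, P a → P b → P (a + b)) (a : FreeStarAlg X) : P a := by
  refine MonoidAlgebra.induction_linear (motive := P) a ?_ hadd ?_
  · have := hw 0 1
    rwa [zero_smul] at this
  · intro w c
    have := hw c w
    rwa [smul_word] at this

/-- The involution: the conjugate-linear extension of `StarWord.adj`. -/
def starAdd : FreeStarAlg X →+ FreeStarAlg X :=
  MonoidAlgebra.liftNC
    (((algebraMap ℂ (FreeStarAlg X)).comp (starRingEnd ℂ) : ℂ →+* FreeStarAlg X) :
      ℂ →+ FreeStarAlg X)
    (fun w => word w.adj)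

theorem starAdd_smul_word (c : ℂ) (w : StarWord X) :
    starAdd (c • word w) = starRingEnd ℂ c • word w.adj := by
  rw [smul_word, Algebra.smul_def]
  exact MonoidAlgebra.liftNC_single _ _ _ _

theorem starAdd_smul (c : ℂ) (a : FreeStarAlg X) :
    starAdd (c • a) = starRingEnd ℂ c • starAdd a := by
  induction a using induction with
  | hw d w => rw [smul_smul, starAdd_smul_word, starAdd_smul_word, map_mul, smul_smul]
  | hadd a b ha hb => rw [smul_add, map_add, map_add, ha, hb, smul_add]

instance instStarRing : StarRing (FreeStarAlg X) where
  star := starAdd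
  star_involutive a := by
    induction a using induction with
    | hw d w => simp [starAdd_smul_word, StarWord.adj_adj]
    | hadd a b ha hb => rw [map_add, map_add, ha, hb]
  star_mul a b := by
    induction a using induction with
    | hw c w =>
      induction b using induction with
      | hw d w' =>
        rw [smul_mul_smul_comm, ← map_mul, starAdd_smul_word, starAdd_smul_word,
          starAdd_smul_word, smul_mul_smul_comm, StarWord.adj_mul, map_mul word, map_mul (starRingEnd ℂ),
          mul_comm]
      | hadd a b ha hb => rw [mul_add, map_add, ha, hb, map_add, add_mul]
    | hadd a b ha hb => rw [add_mul, map_add, ha, hb, map_add, mul_add]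
  star_add := map_add _

instance instStarModule : StarModule ℂ (FreeStarAlg X) where
  star_smul := starAdd_smul

theorem star_word (w : StarWord X) : star (word w) = word w.adj := by
  have h := starAdd_smul_word 1 w
  rw [map_one, one_smul, one_smul] at h
  exact h

section lift

variable {B : Type*} [Ring B] [StarRing B] [Algebra ℂ B] [StarModule ℂ B]

/-- The value on a word of a prescribed map on the generators. -/
def evalWord (f : X → B) : StarWord X →* B :=
  FreeMonoid.lift fun y => if y.2 then star (f y.1) else f y.1

theorem evalWord_adj (f : X → B) (w : StarWord X) :
    evalWord f w.adj = star (evalWord f w) := by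
  induction w using FreeMonoid.inductionOn' with
  | one => simp [StarWord.adj]
  | of_mul y w ih =>
    rw [StarWord.adj_mul, map_mul, map_mul, ih, star_mul]
    congr 1
    obtain ⟨x, b⟩ := y
    cases b <;> simp [StarWord.adj, evalWord]

/-- The algebra homomorphism underlying `FreeStarAlg.lift`. -/
def liftAlg (f : X → B) : FreeStarAlg X →ₐ[ℂ] B :=
  MonoidAlgebra.lift ℂ B (StarWord X) (evalWord f)

theorem liftAlg_word (f : X → B) (w : StarWord X) : liftAlg f (word w) = evalWord f w :=
  MonoidAlgebra.lift_of _ _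

/-- The `*`-homomorphism of the free `*`-algebra with prescribed values on the generators. -/
def lift (f : X → B) : FreeStarAlg X →⋆ₐ[ℂ] B where
  __ := liftAlg f
  map_star' a := by
    change liftAlg f (star a) = star (liftAlg f a)
    induction a using induction with
    | hw c w =>
      rw [star_smul, star_word, map_smul, map_smul, star_smul, liftAlg_word, liftAlg_word,
        evalWord_adj]
    | hadd a b ha hb => rw [star_add, map_add, map_add, ha, hb, star_add]

theorem lift_gen (f : X → B) (x : X) : lift f (gen x) = f x := by
  refine (liftAlg_word f _).trans ?_
  simp [evalWord]

end lift

/-- Two `*`-homomorphisms out of the free `*`-algebra that agree on the generators are equal. -/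
theorem hom_eq {B : Type*} [Ring B] [StarRing B] [Algebra ℂ B]
    (f g : FreeStarAlg X →⋆ₐ[ℂ] B) (h : ∀ x, f (gen x) = g (gen x)) (a : FreeStarAlg X) :
    f a = g a := by
  induction a using induction with
  | hw c w =>
    rw [map_smul, map_smul]
    congr 1
    induction w using FreeMonoid.inductionOn' with
    | one => simp
    | of_mul y w ih =>
      rw [map_mul word, map_mul f, map_mul g, ih]
      congr 1
      obtain ⟨x, b⟩ := y
      cases b
      · exact h x
      · have e : (word (FreeMonoid.of (x, true)) : FreeStarAlg X) = star (gen x) := by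
          rw [gen, star_word]
          simp [StarWord.adj]
        rw [e, map_star, map_star, h]
  | hadd a b ha hb => rw [map_add, map_add, ha, hb]

end FreeStarAlg

/-! ### Semigroups and constructible right ideals -/

section Semigroups

variable {S : Type*} [Semigroup S]

/-- `e` is a (two-sided) identity element of the semigroup `S`. -/
def IsIdentity (e : S) : Prop := ∀ a : S, e * a = a ∧ a * e = a

variable (S) in
/-- The group of units `S*`: the invertible elements of `S`. It is empty if `S` has no identity. -/
def unitSet : Set S := {x | ∃ e : S, IsIdentity e ∧ ∃ y : S, x * y = e ∧ y * x = e}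

/-- The principal right ideal `pS`. -/
def principal (p : S) : Set S := Set.range fun s => p * s

/-- `S` is right LCM: it is left cancellative, and any `p`, `q` with `pS ∩ qS ≠ ∅` have a right
least common multiple `r`, meaning that `pS ∩ qS = rS` and that `r` lies in the right ideals
`{p} ∪ pS` and `{q} ∪ qS` generated by `p` and by `q`. (If `S` has an identity, then
`p ∈ pS` and `r ∈ rS`, so the last requirement is automatic.) -/
def IsRightLCM (S : Type*) [Semigroup S] : Prop :=
  IsLeftCancelMul S ∧ ∀ p q : S, (principal p ∩ principal q).Nonempty →
    ∃ r : S, principal p ∩ principal q = principal r ∧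
      r ∈ insert p (principal p) ∧ r ∈ insert q (principal q)

/-- The family `𝒥(S)` of constructible right ideals: the smallest family of subsets of `S` that
contains `∅` and `S` and is closed under `X ↦ pX` and `X ↦ p⁻¹X = {y | py ∈ X}`. -/
inductive IsConstructible : Set S → Prop
  | empty : IsConstructible ∅
  | univ : IsConstructible Set.univ
  | mul (p : S) {X : Set S} : IsConstructible X → IsConstructible ((fun x => p * x) '' X)
  | preimage (p : S) {X : Set S} : IsConstructible X → IsConstructible ((fun x => p * x) ⁻¹' X)

theorem IsConstructible.inter [IsLeftCancelMul S] {X Y : Set S} (hX : IsConstructible X)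
    (hY : IsConstructible Y) : IsConstructible (X ∩ Y) := by
  induction hX generalizing Y with
  | empty => rw [Set.empty_inter]; exact .empty
  | univ => rwa [Set.univ_inter]
  | @mul p X _ ih =>
    rw [← Set.image_inter_preimage]
    exact (ih (hY.preimage p)).mul p
  | @preimage p X _ ih =>
    have h : (fun x => p * x) ⁻¹' X ∩ Y = (fun x => p * x) ⁻¹' (X ∩ (fun x => p * x) '' Y) := by
      rw [Set.preimage_inter, Set.preimage_image_eq _ (mul_right_injective p)]
    rw [h]
    exact (ih (hY.mul p)).preimage p

variable (S) in
/-- The type `𝒥(S)` of constructible right ideals of `S`. -/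
def ConstructibleIdeal : Type _ := {X : Set S // IsConstructible X}

namespace ConstructibleIdeal

/-- The empty ideal `∅ ∈ 𝒥(S)`. -/
def empty : ConstructibleIdeal S := ⟨∅, .empty⟩

/-- The whole semigroup `S ∈ 𝒥(S)`. -/
def univ : ConstructibleIdeal S := ⟨Set.univ, .univ⟩

/-- The ideal `pX`. -/
def mul (p : S) (X : ConstructibleIdeal S) : ConstructibleIdeal S :=
  ⟨(fun x => p * x) '' X.1, X.2.mul p⟩

/-- The principal right ideal `pS`, as an element of `𝒥(S)`. -/
def principal (p : S) : ConstructibleIdeal S :=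
  ⟨_root_.principal p, by rw [_root_.principal, ← Set.image_univ]; exact IsConstructible.univ.mul p⟩

/-- The ideal `X ∩ Y`. -/
def inter [IsLeftCancelMul S] (X Y : ConstructibleIdeal S) : ConstructibleIdeal S :=
  ⟨X.1 ∩ Y.1, X.2.inter Y.2⟩

theorem inter_comm [IsLeftCancelMul S] (X Y : ConstructibleIdeal S) : X.inter Y = Y.inter X :=
  Subtype.ext (Set.inter_comm _ _)

end ConstructibleIdeal

variable (S) in
/-- Condition (D2): if `s₁ ∈ s₀S` and `F ⊆ S` is finite with `s₁S ⊄ ⋃_{q ∈ F} qS`, then for every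
unit `x ≠ 1` there is `s₂ ∈ s₁S` with `s₂S ⊄ ⋃_{q ∈ F} qS` and `s₀⁻¹s₂S ∩ x s₀⁻¹s₂S = ∅`, where
`s₀⁻¹s₂S = {y | s₀ y ∈ s₂S}`. -/
def ConditionD2 : Prop :=
  ∀ s₀ s₁ : S, s₁ ∈ principal s₀ → ∀ F : Finset S,
    (principal s₁ ∩ (⋃ q ∈ F, principal q)ᶜ).Nonempty →
      ∀ x ∈ unitSet S, ¬ IsIdentity x →
        ∃ s₂ ∈ principal s₁, (principal s₂ ∩ (⋃ q ∈ F, principal q)ᶜ).Nonempty ∧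
          ((fun y => s₀ * y) ⁻¹' principal s₂) ∩
            ((fun y => x * y) '' ((fun y => s₀ * y) ⁻¹' principal s₂)) = ∅

end Semigroups

/-! ### The full semigroup C⋆-algebra -/

/-- Isometries `V p`, `p ∈ S`, and projections `E X`, `X ∈ 𝒥(S)`, in a unital `*`-algebra that
satisfy the defining relations of `C*(S)`: `V p V q = V (pq)`, `V p E X (V p)⋆ = E (pX)`,
`E ∅ = 0`, `E S = 1` and `E X E Y = E (X ∩ Y)`. -/
structure IsLiFamily {S : Type*} [Semigroup S] [IsLeftCancelMul S] {B : Type*} [Ring B]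
    [StarRing B] (V : S → B) (E : ConstructibleIdeal S → B) : Prop where
  isometry : ∀ p, star (V p) * V p = 1
  projection : ∀ X, IsStarProjection (E X)
  mul : ∀ p q, V p * V q = V (p * q)
  conj : ∀ p X, V p * E X * star (V p) = E (X.mul p)
  empty : E .empty = 0
  univ : E .univ = 1
  inter : ∀ X Y, E X * E Y = E (X.inter Y)

/-- The factors `1 - E_{pS}` commute with each other. -/
theorem IsLiFamily.commute {S : Type*} [Semigroup S] [IsLeftCancelMul S] {B : Type*} [Ring B]
    [StarRing B] {V : S → B} {E : ConstructibleIdeal S → B} (h : IsLiFamily V E) (p q : S) :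
    Commute (1 - E (.principal p)) (1 - E (.principal q)) := by
  have hc : Commute (E (.principal p)) (E (.principal q)) := by
    rw [Commute, SemiconjBy, h.inter, h.inter, ConstructibleIdeal.inter_comm]
  exact (Commute.one_left _).sub_left ((Commute.one_right _).sub_right hc)

section FullCStar

variable (S : Type*) [Semigroup S]

/-- The free unital `*`-algebra on symbols `v p`, `p ∈ S`, and `e X`, `X ∈ 𝒥(S)`; below it
carries the largest C⋆-seminorm that respects the relations. -/
def PreSemigroupCStar : Type _ := FreeStarAlg (S ⊕ ConstructibleIdeal S)

namespace PreSemigroupCStar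

instance instRing : Ring (PreSemigroupCStar S) := inferInstanceAs (Ring (FreeStarAlg _))
instance instAlgebra : Algebra ℂ (PreSemigroupCStar S) :=
  inferInstanceAs (Algebra ℂ (FreeStarAlg _))
instance instStarRing : StarRing (PreSemigroupCStar S) :=
  inferInstanceAs (StarRing (FreeStarAlg _))
instance instStarModule : StarModule ℂ (PreSemigroupCStar S) :=
  inferInstanceAs (StarModule ℂ (FreeStarAlg _))

variable {S}

/-- The generator `v p`. -/
def v (p : S) : PreSemigroupCStar S := FreeStarAlg.gen (Sum.inl p)

/-- The generator `e X`. -/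
def e (X : ConstructibleIdeal S) : PreSemigroupCStar S := FreeStarAlg.gen (Sum.inr X)

/-- The C⋆-seminorms on the free `*`-algebra for which the `v p` are isometries and the `e X` are
projections satisfying the relations of `IsLiFamily`. -/
structure IsLiSeminorm [IsLeftCancelMul S] (N : RingSeminorm (PreSemigroupCStar S)) : Prop where
  smul : ∀ (c : ℂ) a, N (c • a) = ‖c‖ * N a
  cstar : ∀ a, N (star a * a) = N a ^ 2
  isometry : ∀ p, N (star (v p) * v p - 1) = 0
  selfAdjoint : ∀ X, N (star (e X) - e X) = 0
  idempotent : ∀ X, N (e X * e X - e X) = 0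
  mul : ∀ p q, N (v p * v q - v (p * q)) = 0
  conj : ∀ p X, N (v p * e X * star (v p) - e (X.mul p)) = 0
  empty : N (e .empty) = 0
  univ : N (e .univ - 1) = 0
  inter : ∀ X Y, N (e X * e Y - e (X.inter Y)) = 0

variable [IsLeftCancelMul S]

theorem IsLiSeminorm.eq_of_sub {N : RingSeminorm (PreSemigroupCStar S)}
    {a b : PreSemigroupCStar S} (h : N (a - b) = 0) : N a = N b := by
  apply le_antisymm
  · calc N a = N (a - b + b) := by rw [sub_add_cancel]
      _ ≤ N (a - b) + N b := map_add_le_add N _ _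
      _ = N b := by rw [h, zero_add]
  · calc N b = N (a - (a - b)) := by rw [sub_sub_cancel]
      _ ≤ N a + N (a - b) := map_sub_le_add N _ _
      _ = N a := by rw [h, add_zero]

theorem IsLiSeminorm.star_eq {N : RingSeminorm (PreSemigroupCStar S)} (h : IsLiSeminorm N)
    (a : PreSemigroupCStar S) : N (star a) = N a := by
  have key : ∀ a, N a ≤ N (star a) := fun a => by
    rcases (apply_nonneg N a).eq_or_lt with h0 | h0
    · rw [← h0]; exact apply_nonneg N _
    · have h1 := map_mul_le_mul N (star a) a
      rw [h.cstar, sq] at h1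
      exact le_of_mul_le_mul_right h1 h0
  exact le_antisymm (by simpa using key (star a)) (key a)

theorem IsLiSeminorm.one_le {N : RingSeminorm (PreSemigroupCStar S)} (h : IsLiSeminorm N) :
    N 1 ≤ 1 := by
  have h1 := h.cstar 1
  rw [star_one, one_mul] at h1
  nlinarith [apply_nonneg N 1]

theorem IsLiSeminorm.v_le {N : RingSeminorm (PreSemigroupCStar S)} (h : IsLiSeminorm N) (p : S) :
    N (v p) ≤ 1 := by
  have h1 := h.cstar (v p)
  rw [eq_of_sub (h.isometry p)] at h1
  nlinarith [apply_nonneg N (v p), h.one_le]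

theorem IsLiSeminorm.e_le {N : RingSeminorm (PreSemigroupCStar S)} (h : IsLiSeminorm N)
    (X : ConstructibleIdeal S) : N (e X) ≤ 1 := by
  have h0 : N (star (e X) * e X - e X * e X) = 0 := by
    apply le_antisymm _ (apply_nonneg N _)
    rw [← sub_mul]
    refine (map_mul_le_mul N _ _).trans ?_
    rw [h.selfAdjoint, zero_mul]
  have h1 := h.cstar (e X)
  rw [eq_of_sub h0, eq_of_sub (h.idempotent X)] at h1
  nlinarith [apply_nonneg N (e X)]

theorem IsLiSeminorm.word_le {N : RingSeminorm (PreSemigroupCStar S)} (h : IsLiSeminorm N)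
    (w : StarWord (S ⊕ ConstructibleIdeal S)) :
    N (FreeStarAlg.word w : FreeStarAlg (S ⊕ ConstructibleIdeal S)) ≤ 1 := by
  induction w using FreeMonoid.inductionOn' with
  | one => rw [map_one FreeStarAlg.word]; exact h.one_le
  | of_mul y w ih =>
    rw [map_mul FreeStarAlg.word]
    refine (map_mul_le_mul N _ _).trans ?_
    refine mul_le_one₀ ?_ (apply_nonneg N _) ih
    have hg : ∀ x, N (FreeStarAlg.gen x : FreeStarAlg (S ⊕ ConstructibleIdeal S)) ≤ 1 := by
      rintro (p | X)
      · exact h.v_le p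
      · exact h.e_le X
    obtain ⟨x, b⟩ := y
    cases b
    · exact hg x
    · have e : (FreeStarAlg.word (FreeMonoid.of (x, true)) :
          FreeStarAlg (S ⊕ ConstructibleIdeal S)) = star (FreeStarAlg.gen x) := by
        rw [FreeStarAlg.gen, FreeStarAlg.star_word]
        simp [StarWord.adj]
      rw [e]
      exact (h.star_eq _).trans_le (hg x)

theorem exists_bound (a : PreSemigroupCStar S) :
    ∃ C : ℝ, ∀ N : RingSeminorm (PreSemigroupCStar S), IsLiSeminorm N → N a ≤ C := by
  induction a using FreeStarAlg.induction with
  | hw c w =>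
    refine ⟨‖c‖, fun N h => (h.smul c _).trans_le ?_⟩
    exact mul_le_of_le_one_right (norm_nonneg c) (h.word_le w)
  | hadd a b ha hb =>
    obtain ⟨C, hC⟩ := ha
    obtain ⟨D, hD⟩ := hb
    exact ⟨C + D, fun N h => (map_add_le_add N _ _).trans (add_le_add (hC N h) (hD N h))⟩

/-- The largest C⋆-seminorm respecting the relations. -/
def maxSeminorm (a : PreSemigroupCStar S) : ℝ :=
  ⨆ N : {N : RingSeminorm (PreSemigroupCStar S) // IsLiSeminorm N}, N.1 a

theorem le_maxSeminorm {N : RingSeminorm (PreSemigroupCStar S)} (h : IsLiSeminorm N)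
    (a : PreSemigroupCStar S) : N a ≤ maxSeminorm a := by
  obtain ⟨C, hC⟩ := exists_bound a
  exact le_ciSup (f := fun N : {N : RingSeminorm (PreSemigroupCStar S) // IsLiSeminorm N} => N.1 a)
    ⟨C, by rintro _ ⟨N, rfl⟩; exact hC N.1 N.2⟩ ⟨N, h⟩

theorem maxSeminorm_nonneg (a : PreSemigroupCStar S) : 0 ≤ maxSeminorm a :=
  Real.iSup_nonneg fun N => apply_nonneg N.1 a

theorem maxSeminorm_le {a : PreSemigroupCStar S} {C : ℝ} (hC : 0 ≤ C)
    (h : ∀ N : RingSeminorm (PreSemigroupCStar S), IsLiSeminorm N → N a ≤ C) :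
    maxSeminorm a ≤ C :=
  Real.iSup_le (fun N => h N.1 N.2) hC

theorem maxSeminorm_eq_zero {a : PreSemigroupCStar S}
    (h : ∀ N : RingSeminorm (PreSemigroupCStar S), IsLiSeminorm N → N a = 0) :
    maxSeminorm a = 0 :=
  le_antisymm (maxSeminorm_le le_rfl fun N hN => (h N hN).le) (maxSeminorm_nonneg a)

theorem maxSeminorm_smul (c : ℂ) (a : PreSemigroupCStar S) :
    maxSeminorm (c • a) = ‖c‖ * maxSeminorm a := by
  rw [maxSeminorm, maxSeminorm, Real.mul_iSup_of_nonneg (norm_nonneg c)]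
  exact iSup_congr fun N => N.2.smul c a

theorem maxSeminorm_cstar (a : PreSemigroupCStar S) :
    maxSeminorm (star a * a) = maxSeminorm a ^ 2 := by
  apply le_antisymm
  · refine maxSeminorm_le (sq_nonneg _) fun N hN => ?_
    rw [hN.cstar]
    exact pow_le_pow_left₀ (apply_nonneg N a) (le_maxSeminorm hN a) 2
  · have h : maxSeminorm a ≤ √(maxSeminorm (star a * a)) := by
      refine maxSeminorm_le (Real.sqrt_nonneg _) fun N hN => Real.le_sqrt_of_sq_le ?_
      rw [← hN.cstar]
      exact le_maxSeminorm hN _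
    calc maxSeminorm a ^ 2 ≤ √(maxSeminorm (star a * a)) ^ 2 :=
          pow_le_pow_left₀ (maxSeminorm_nonneg a) h 2
      _ = maxSeminorm (star a * a) := Real.sq_sqrt (maxSeminorm_nonneg _)

theorem maxSeminorm_star (a : PreSemigroupCStar S) : maxSeminorm (star a) = maxSeminorm a :=
  iSup_congr fun N => N.2.star_eq a

/-- `maxSeminorm`, bundled. -/
def maxRingSeminorm : RingSeminorm (PreSemigroupCStar S) where
  toFun := maxSeminorm
  map_zero' := maxSeminorm_eq_zero fun N _ => map_zero N
  add_le' a b := maxSeminorm_le (add_nonneg (maxSeminorm_nonneg a) (maxSeminorm_nonneg b))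
    fun N hN => (map_add_le_add N a b).trans (add_le_add (le_maxSeminorm hN a) (le_maxSeminorm hN b))
  neg' a := iSup_congr fun N => map_neg_eq_map N.1 a
  mul_le' a b := maxSeminorm_le (mul_nonneg (maxSeminorm_nonneg a) (maxSeminorm_nonneg b))
    fun N hN => (map_mul_le_mul N a b).trans (mul_le_mul (le_maxSeminorm hN a)
      (le_maxSeminorm hN b) (apply_nonneg N b) (maxSeminorm_nonneg a))

instance instSeminormedRing : SeminormedRing (PreSemigroupCStar S) where
  __ := instRing S
  __ := (maxRingSeminorm (S := S)).toSeminormedRing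

theorem norm_def (a : PreSemigroupCStar S) : ‖a‖ = maxSeminorm a := rfl

instance instNormedAlgebra : NormedAlgebra ℂ (PreSemigroupCStar S) where
  __ := instAlgebra S
  norm_smul_le c a := (maxSeminorm_smul c a).le

instance instNormedStarGroup : NormedStarGroup (PreSemigroupCStar S) where
  norm_star_le a := (maxSeminorm_star a).le

end PreSemigroupCStar

/-- The full semigroup C⋆-algebra `C*(S)`: the universal unital C⋆-algebra generated by isometries
`v p` and projections `e X` subject to the relations of `IsLiFamily`. It is the Hausdorff completion
of the free `*`-algebra on these symbols in the largest C⋆-seminorm respecting them; its universal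
property is `SemigroupCStar.lift` with `SemigroupCStar.lift_v`, `SemigroupCStar.lift_e` and
`SemigroupCStar.hom_ext`. -/
def SemigroupCStar [IsLeftCancelMul S] : Type _ := UniformSpace.Completion (PreSemigroupCStar S)

namespace SemigroupCStar

open UniformSpace (Completion)

variable [IsLeftCancelMul S]

instance instNormedRing : NormedRing (SemigroupCStar S) :=
  inferInstanceAs (NormedRing (Completion (PreSemigroupCStar S)))

instance instCompleteSpace : CompleteSpace (SemigroupCStar S) :=
  inferInstanceAs (CompleteSpace (Completion (PreSemigroupCStar S)))

instance instNormedAlgebra : NormedAlgebra ℂ (SemigroupCStar S) where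
  __ := (inferInstanceAs (Algebra ℂ (Completion (PreSemigroupCStar S))) :
    Algebra ℂ (SemigroupCStar S))
  norm_smul_le c a := norm_smul_le (β := Completion (PreSemigroupCStar S)) c a

variable {S}

/-- The canonical map of the free `*`-algebra into `C*(S)`. -/
def ofPre : PreSemigroupCStar S →+* SemigroupCStar S := Completion.coeRingHom

theorem norm_ofPre (a : PreSemigroupCStar S) : ‖ofPre a‖ = PreSemigroupCStar.maxSeminorm a :=
  Completion.norm_coe a

theorem continuous_ofPre : Continuous (ofPre (S := S)) := Completion.continuous_coe _

theorem ofPre_smul (c : ℂ) (a : PreSemigroupCStar S) : ofPre (c • a) = c • ofPre a :=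
  Completion.coe_smul c a

theorem induction {P : SemigroupCStar S → Prop} (hc : IsClosed {a | P a})
    (h : ∀ a, P (ofPre a)) (a : SemigroupCStar S) : P a :=
  Completion.induction_on a hc h

instance instStar : Star (SemigroupCStar S) where
  star := Completion.map (star : PreSemigroupCStar S → PreSemigroupCStar S)

theorem continuous_star' : Continuous (star : SemigroupCStar S → SemigroupCStar S) :=
  Completion.continuous_map

theorem star_ofPre (a : PreSemigroupCStar S) : star (ofPre a) = ofPre (star a) :=
  Completion.map_coe (starNormedAddGroupHom (E := PreSemigroupCStar S)).uniformContinuous a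

instance instStarRing : StarRing (SemigroupCStar S) where
  star_involutive a := by
    refine induction (P := fun a => star (star a) = a)
      (isClosed_eq (continuous_star'.comp continuous_star') continuous_id) (fun a => ?_) a
    rw [star_ofPre, star_ofPre, star_star]
  star_add a b := by
    refine Completion.induction_on₂ (p := fun a b : SemigroupCStar S =>
      star (a + b) = star a + star b) a b (isClosed_eq ?_ ?_) fun a b => ?_
    · exact continuous_star'.comp (continuous_fst.add continuous_snd)
    · exact (continuous_star'.comp continuous_fst).add (continuous_star'.comp continuous_snd)
    · change star (ofPre a + ofPre b) = star (ofPre a) + star (ofPre b)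
      rw [← map_add, star_ofPre, star_ofPre, star_ofPre, star_add, map_add]
  star_mul a b := by
    refine Completion.induction_on₂ (p := fun a b : SemigroupCStar S =>
      star (a * b) = star b * star a) a b (isClosed_eq ?_ ?_) fun a b => ?_
    · exact continuous_star'.comp (continuous_fst.mul continuous_snd)
    · exact (continuous_star'.comp continuous_snd).mul (continuous_star'.comp continuous_fst)
    · change star (ofPre a * ofPre b) = star (ofPre b) * star (ofPre a)
      rw [← map_mul, star_ofPre, star_ofPre, star_ofPre, star_mul, map_mul]

instance instStarModule : StarModule ℂ (SemigroupCStar S) where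
  star_smul c a := by
    refine induction (P := fun a => star (c • a) = star c • star a)
      (isClosed_eq (continuous_star'.comp (continuous_const_smul c))
        (continuous_star'.const_smul (star c))) (fun a => ?_) a
    rw [← ofPre_smul, star_ofPre, star_ofPre, star_smul, ofPre_smul]

instance instCStarRing : CStarRing (SemigroupCStar S) where
  norm_mul_self_le a := by
    refine induction (P := fun a => ‖a‖ * ‖a‖ ≤ ‖star a * a‖)
      (isClosed_le (continuous_norm.mul continuous_norm)
        (continuous_norm.comp (continuous_star'.mul continuous_id))) (fun a => ?_) a
    rw [star_ofPre, ← map_mul, norm_ofPre, norm_ofPre, PreSemigroupCStar.maxSeminorm_cstar, sq]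

instance instCStarAlgebra : CStarAlgebra (SemigroupCStar S) where

/-- The generating isometry `v p` of `C*(S)`. -/
def v (p : S) : SemigroupCStar S := ofPre (PreSemigroupCStar.v p)

/-- The generating projection `e X` of `C*(S)`. -/
def e (X : ConstructibleIdeal S) : SemigroupCStar S := ofPre (PreSemigroupCStar.e X)

theorem ofPre_eq {a b : PreSemigroupCStar S}
    (h : ∀ N : RingSeminorm (PreSemigroupCStar S), PreSemigroupCStar.IsLiSeminorm N →
      N (a - b) = 0) : ofPre a = ofPre b := by
  rw [← sub_eq_zero, ← map_sub, ← norm_eq_zero, norm_ofPre]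
  exact PreSemigroupCStar.maxSeminorm_eq_zero h

variable (S) in
/-- The generators of `C*(S)` satisfy the defining relations. -/
theorem isLiFamily : IsLiFamily (v (S := S)) e where
  isometry p := by
    rw [v, star_ofPre, ← map_mul, ← map_one ofPre]
    exact ofPre_eq fun N h => h.isometry p
  projection X := by
    refine ⟨?_, ?_⟩
    · rw [IsIdempotentElem, e, ← map_mul]
      exact ofPre_eq fun N h => h.idempotent X
    · rw [IsSelfAdjoint, e, star_ofPre]
      exact ofPre_eq fun N h => h.selfAdjoint X
  mul p q := by
    rw [v, v, v, ← map_mul]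
    exact ofPre_eq fun N h => h.mul p q
  conj p X := by
    rw [v, e, e, star_ofPre, ← map_mul, ← map_mul]
    exact ofPre_eq fun N h => h.conj p X
  empty := by
    rw [e, ← map_zero ofPre]
    exact ofPre_eq fun N h => by rw [sub_zero]; exact h.empty
  univ := by
    rw [e, ← map_one ofPre]
    exact ofPre_eq fun N h => h.univ
  inter X Y := by
    rw [e, e, e, ← map_mul]
    exact ofPre_eq fun N h => h.inter X Y

section lift

variable {B : Type*} [CStarAlgebra B] {V : S → B} {E : ConstructibleIdeal S → B}

/-- The `*`-homomorphism of the free `*`-algebra given by `V` and `E`. -/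
def preLift (V : S → B) (E : ConstructibleIdeal S → B) : PreSemigroupCStar S →⋆ₐ[ℂ] B :=
  FreeStarAlg.lift (Sum.elim V E)

theorem preLift_v (p : S) : preLift V E (PreSemigroupCStar.v p) = V p :=
  FreeStarAlg.lift_gen _ _

theorem preLift_e (X : ConstructibleIdeal S) : preLift V E (PreSemigroupCStar.e X) = E X :=
  FreeStarAlg.lift_gen _ _

/-- The C⋆-seminorm `a ↦ ‖preLift V E a‖`. -/
def liftSeminorm (V : S → B) (E : ConstructibleIdeal S → B) :
    RingSeminorm (PreSemigroupCStar S) where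
  toFun a := ‖preLift V E a‖
  map_zero' := by rw [map_zero, norm_zero]
  add_le' a b := by rw [map_add]; exact norm_add_le _ _
  neg' a := by rw [map_neg, norm_neg]
  mul_le' a b := by rw [map_mul]; exact norm_mul_le _ _

theorem liftSeminorm_apply (a : PreSemigroupCStar S) : liftSeminorm V E a = ‖preLift V E a‖ := rfl

theorem isLiSeminorm_liftSeminorm (h : IsLiFamily V E) :
    PreSemigroupCStar.IsLiSeminorm (liftSeminorm V E) where
  smul c a := by rw [liftSeminorm_apply, liftSeminorm_apply, map_smul, norm_smul]
  cstar a := by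
    rw [liftSeminorm_apply, liftSeminorm_apply, map_mul, map_star, CStarRing.norm_star_mul_self, sq]
  isometry p := by
    rw [liftSeminorm_apply, map_sub, map_mul, map_star, map_one, preLift_v, h.isometry, sub_self,
      norm_zero]
  selfAdjoint X := by
    rw [liftSeminorm_apply, map_sub, map_star, preLift_e, (h.projection X).isSelfAdjoint.star_eq,
      sub_self, norm_zero]
  idempotent X := by
    rw [liftSeminorm_apply, map_sub, map_mul, preLift_e, (h.projection X).isIdempotentElem.eq,
      sub_self, norm_zero]
  mul p q := by
    rw [liftSeminorm_apply, map_sub, map_mul, preLift_v, preLift_v, preLift_v, h.mul, sub_self,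
      norm_zero]
  conj p X := by
    rw [liftSeminorm_apply, map_sub, map_mul, map_mul, map_star, preLift_v, preLift_e, preLift_e,
      h.conj, sub_self, norm_zero]
  empty := by rw [liftSeminorm_apply, preLift_e, h.empty, norm_zero]
  univ := by rw [liftSeminorm_apply, map_sub, map_one, preLift_e, h.univ, sub_self, norm_zero]
  inter X Y := by
    rw [liftSeminorm_apply, map_sub, map_mul, preLift_e, preLift_e, preLift_e, h.inter, sub_self,
      norm_zero]

theorem norm_preLift_le (h : IsLiFamily V E) (a : PreSemigroupCStar S) :
    ‖preLift V E a‖ ≤ ‖a‖ :=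
  PreSemigroupCStar.le_maxSeminorm (isLiSeminorm_liftSeminorm h) a

theorem continuous_preLift (h : IsLiFamily V E) : Continuous (preLift V E) :=
  AddMonoidHomClass.continuous_of_bound (preLift V E) 1 fun a => by
    rw [one_mul]; exact norm_preLift_le h a

/-- The universal property of `C*(S)`: the `*`-homomorphism `π_{V,E} : C*(S) → B` associated with
a family satisfying the defining relations. -/
def lift (h : IsLiFamily V E) : SemigroupCStar S →⋆ₐ[ℂ] B :=
  let φ : SemigroupCStar S →+* B := Completion.extensionHom
    ((preLift V E : PreSemigroupCStar S →ₐ[ℂ] B) : PreSemigroupCStar S →+* B) (continuous_preLift h)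
  have hφ : Continuous φ := Completion.continuous_extension
  have hof : ∀ a, φ (ofPre a) = preLift V E a := fun a => Completion.extensionHom_coe _ _ a
  { φ with
    commutes' := fun c => by
      have h1 : algebraMap ℂ (SemigroupCStar S) c = ofPre (c • 1) := by
        rw [ofPre_smul, map_one, Algebra.algebraMap_eq_smul_one]
      change φ (algebraMap ℂ (SemigroupCStar S) c) = _
      rw [h1, hof, map_smul, map_one, Algebra.algebraMap_eq_smul_one]
    map_star' := fun a => by
      change φ (star a) = star (φ a)
      refine induction (P := fun a => φ (star a) = star (φ a))
        (isClosed_eq (hφ.comp continuous_star') (continuous_star.comp hφ)) (fun a => ?_) a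
      rw [star_ofPre, hof, hof, map_star] }

theorem lift_ofPre (h : IsLiFamily V E) (a : PreSemigroupCStar S) :
    lift h (ofPre a) = preLift V E a :=
  Completion.extensionHom_coe _ (continuous_preLift h) a

theorem lift_v (h : IsLiFamily V E) (p : S) : lift h (v p) = V p :=
  (lift_ofPre h _).trans (preLift_v p)

theorem lift_e (h : IsLiFamily V E) (X : ConstructibleIdeal S) : lift h (e X) = E X :=
  (lift_ofPre h _).trans (preLift_e X)

open scoped CStarAlgebra in
/-- A `*`-homomorphism on `C*(S)` is determined by its values on the generators. -/
theorem hom_ext {f g : SemigroupCStar S →⋆ₐ[ℂ] B} (hv : ∀ p, f (v p) = g (v p))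
    (he : ∀ X, f (e X) = g (e X)) : f = g := by
  let ι : PreSemigroupCStar S →⋆ₐ[ℂ] SemigroupCStar S :=
    { (ofPre : PreSemigroupCStar S →+* SemigroupCStar S) with
      commutes' := fun c => by
        change ofPre (algebraMap ℂ (PreSemigroupCStar S) c) = _
        rw [Algebra.algebraMap_eq_smul_one, ofPre_smul, map_one, Algebra.algebraMap_eq_smul_one]
      map_star' := fun a => (star_ofPre a).symm }
  refine StarAlgHom.ext fun a => ?_
  refine induction (P := fun a => f a = g a)
    (isClosed_eq (map_continuous f) (map_continuous g)) (fun a => ?_) a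
  exact FreeStarAlg.hom_eq (f.comp ι) (g.comp ι) (by rintro (p | X); exacts [hv p, he X]) a

end lift

variable (S) in
/-- The diagonal `𝒟`: the C⋆-subalgebra of `C*(S)` generated by the projections `e X`. (It is
unital since `e S = 1`.) -/
def diagonal : StarSubalgebra ℂ (SemigroupCStar S) :=
  (StarAlgebra.adjoin ℂ (Set.range (e (S := S)))).topologicalClosure

end SemigroupCStar
end FullCStar

/-- `Φ` is a conditional expectation of the C⋆-algebra `A` onto its C⋆-subalgebra `D`: a
contractive linear projection of `A` onto `D`. (By Tomiyama's theorem, `Φ` is then completely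
positive and `D`-bimodular.) -/
structure IsConditionalExpectation {A : Type*} [CStarAlgebra A] (D : StarSubalgebra ℂ A)
    (Φ : A →ₗ[ℂ] A) : Prop where
  map_mem : ∀ a, Φ a ∈ D
  map_of_mem : ∀ a ∈ D, Φ a = a
  norm_le : ∀ a, ‖Φ a‖ ≤ ‖a‖

/-- `Φ` is faithful on positive elements: `Φ (a⋆a) = 0` only if `a = 0`. -/
def IsFaithfulMap {A : Type*} [CStarAlgebra A] (Φ : A →ₗ[ℂ] A) : Prop :=
  ∀ a, Φ (star a * a) = 0 → a = 0

/-- `Φ` takes the values of the diagonal expectation `Φ_𝒟` on the spanning elements of `C*(S)`: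
`v p (v q)⋆ ↦ v p (v p)⋆` if `p = q`, and `v p (v q)⋆ ↦ 0` if `p ≠ q`. Here `p` and `q` range
over `S` if `S` has an identity, and over the unitisation `S ∪ {1}`, with `v 1 = 1`, if not. -/
structure IsDiagonalMap {S : Type*} [Semigroup S] [IsLeftCancelMul S]
    (Φ : SemigroupCStar S →ₗ[ℂ] SemigroupCStar S) : Prop where
  map_same : ∀ p : S, Φ (.v p * star (.v p)) = .v p * star (.v p)
  map_ne : ∀ p q : S, p ≠ q → Φ (.v p * star (.v q)) = 0
  map_one : (¬ ∃ i : S, IsIdentity i) → Φ 1 = 1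
  map_v : (¬ ∃ i : S, IsIdentity i) → ∀ p : S, Φ (.v p) = 0
  map_star_v : (¬ ∃ i : S, IsIdentity i) → ∀ p : S, Φ (star (.v p)) = 0

/-- The canonical map `Φ_𝒟 : C*(S) → 𝒟` exists and is a faithful conditional expectation. -/
def HasFaithfulDiagonalExpectation (S : Type*) [Semigroup S] [IsLeftCancelMul S] : Prop :=
  ∃ Φ : SemigroupCStar S →ₗ[ℂ] SemigroupCStar S,
    IsDiagonalMap Φ ∧ IsConditionalExpectation (SemigroupCStar.diagonal S) Φ ∧ IsFaithfulMap Φ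

end

/-!
The proof compares `π = lift h` with the diagonal expectation `Φ`: it suffices that
`‖Φ a‖ ≤ ‖π a‖` for all `a`, since then `π a = 0` gives `Φ (a⋆a) = 0` and `a = 0` by faithfulness.

Let `M` be `S` if `S` has an identity and the unitisation of `S` otherwise, so that `M` is a
cancellative monoid. The generators of `C*(S)` give a representation `W` of `M` by isometries that
is Nica covariant (`IsNicaRep`), and the elements `W p (W q)⋆` span a dense subspace
(`SemigroupCStar.dense_span_mul_star`), because in a right LCM semigroup all constructible ideals
other than `∅` and `S` are principal.

For `a = ∑ c (p, q) W p (W q)⋆` the element `Φ a` is a combination of commuting range projections.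
A character attaining its norm singles out some `s : M` and a finite set `C` of elements not
dividing `s` on the left such that `‖Φ a‖` is the modulus of the sum of the `c (p, p)` with
`p ∣ s`, and every other index `p` lies in `C` (`IsNicaRep.exists_norm_sum_eq`). Any projection `Q`
in `B` below the range projection of `s` and orthogonal to those of `C` then compresses the diagonal
part of `π a` to this scalar. Enlarging `s` and `C` while keeping `s` outside `⋃ q ∈ C, qM`, one can
arrange that `Q` annihilates any given off-diagonal `W p (W q)⋆` (`IsNicaRep.exists_refine_pair`).
Here either a non-unit can be added to `C`, or `s = p a = q a x` for a unit `x ≠ 1`, which is where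
condition (D2) is used. The assumption on products guarantees that a nonzero such `Q` exists
(`IsNicaRep.exists_subordinate`).

Conversely, the products are nonzero in `C*(S)`, since in the left regular representation they fix
a basis vector outside the ideals `pS`: finitely many principal right ideals of non-units do not
cover `S` (`exists_forall_notMem_principal`).
-/

noncomputable section

/-! ### Characters and projections -/

/-- The norm of an element of the commutative `*`-algebra generated by commuting self-adjoint
elements is attained by a character. -/
theorem exists_character_norm_eq {A : Type*} [CStarAlgebra A] [Nontrivial A] {s : Set A}
    (hsa : ∀ a ∈ s, IsSelfAdjoint a) (hcomm : ∀ a ∈ s, ∀ b ∈ s, a * b = b * a)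
    (x : StarAlgebra.adjoin ℂ s) :
    ∃ χ : StarAlgebra.adjoin ℂ s →ₐ[ℂ] ℂ, ‖χ x‖ = ‖x‖ := by
  have hc := StarAlgebra.isMulCommutative_adjoin ℂ hcomm
    fun a ha b hb => by rw [(hsa b hb).star_eq]; exact hcomm a ha b hb
  have hc' : ∀ a b : StarAlgebra.adjoin ℂ s, a * b = b * a := hc.is_comm.comm
  let D := (StarAlgebra.adjoin ℂ s).topologicalClosure
  have hclosed : IsClosed (D : Set A) := (StarAlgebra.adjoin ℂ s).isClosed_topologicalClosure
  let _ : CStarAlgebra D := StarSubalgebra.cstarAlgebra _ (h_closed := hclosed)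
  let _ : CommCStarAlgebra D :=
    { (inferInstance : CStarAlgebra D) with
      mul_comm := ((StarAlgebra.adjoin ℂ s).commRingTopologicalClosure hc').mul_comm }
  let ι := StarSubalgebra.inclusion (StarAlgebra.adjoin ℂ s).le_topologicalClosure
  obtain ⟨z, hz, hzn⟩ := spectrum.exists_nnnorm_eq_spectralRadius (ι x)
  have hnormal : IsStarNormal (ι x) := ⟨mul_comm _ _⟩
  rw [IsStarNormal.spectralRadius_eq_nnnorm, ENNReal.coe_inj] at hzn
  obtain ⟨χ, rfl⟩ := WeakDual.CharacterSpace.mem_spectrum_iff_exists.1 hz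
  exact ⟨(WeakDual.CharacterSpace.toAlgHom χ).comp ι.toAlgHom, congrArg NNReal.toReal hzn⟩

theorem norm_eq_one_of_isStarProjection {A : Type*} [CStarAlgebra A] {Q : A}
    (hQ : IsStarProjection Q) (h0 : Q ≠ 0) : ‖Q‖ = 1 := by
  have h1 := CStarRing.norm_star_mul_self (x := Q)
  rw [hQ.isSelfAdjoint.star_eq, hQ.isIdempotentElem.eq] at h1
  exact (mul_left_cancel₀ (norm_ne_zero_iff.2 h0) (by rw [← h1, mul_one])).symm

/-! ### Nica covariant representations of monoids -/

/-- A representation of a monoid by isometries in which `(W p)⋆ W q` is either zero or equal to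
`W p' (W q')⋆` for a common right multiple `p p' = q q'`. For right LCM monoids this is Nica
covariance. -/
structure IsNicaRep {M A : Type*} [Monoid M] [Ring A] [StarRing A] (W : M →* A) : Prop where
  isometry : ∀ p, star (W p) * W p = 1
  nica : ∀ p q, star (W p) * W q = 0 ∨
    ∃ p' q', p * p' = q * q' ∧ star (W p) * W q = W p' * star (W q')

/-- The range projection `W p (W p)⋆`. -/
def rangeProj {M A : Type*} [Monoid M] [Ring A] [StarRing A] (W : M →* A) (p : M) : A :=
  W p * star (W p)

namespace IsNicaRep

section Ring

variable {M A : Type*} [Monoid M] [Ring A] [StarRing A] {W : M →* A}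

theorem isStarProjection (h : IsNicaRep W) (p : M) : IsStarProjection (rangeProj W p) := by
  refine ⟨?_, ?_⟩
  · rw [IsIdempotentElem, rangeProj, mul_assoc, ← mul_assoc (star (W p)), h.isometry, one_mul]
  · rw [IsSelfAdjoint, rangeProj, star_mul, star_star]

theorem rangeProj_mul_apply (h : IsNicaRep W) (p : M) : rangeProj W p * W p = W p := by
  rw [rangeProj, mul_assoc, h.isometry, mul_one]

theorem star_mul_rangeProj (h : IsNicaRep W) (p : M) : star (W p) * rangeProj W p = star (W p) := by
  rw [rangeProj, ← mul_assoc, h.isometry, one_mul]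

theorem rangeProj_mul (h : IsNicaRep W) (p q : M) :
    rangeProj W p * rangeProj W q = 0 ∨
      ∃ r, p ∣ r ∧ q ∣ r ∧ rangeProj W p * rangeProj W q = rangeProj W r := by
  have e : rangeProj W p * rangeProj W q = W p * (star (W p) * W q) * star (W q) := by
    simp only [rangeProj, mul_assoc]
  rcases h.nica p q with h0 | ⟨p', q', hpq, h1⟩
  · left
    rw [e, h0, mul_zero, zero_mul]
  · refine Or.inr ⟨p * p', dvd_mul_right _ _, ⟨q', hpq⟩, ?_⟩
    rw [e, h1, ← mul_assoc, mul_assoc, ← star_mul, ← map_mul, ← map_mul, ← hpq, rangeProj]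

theorem commute (h : IsNicaRep W) (p q : M) :
    rangeProj W p * rangeProj W q = rangeProj W q * rangeProj W p := by
  have hsa : IsSelfAdjoint (rangeProj W p * rangeProj W q) := by
    rcases h.rangeProj_mul p q with h0 | ⟨r, -, -, hr⟩
    · rw [h0]; exact .zero A
    · rw [hr]; exact (h.isStarProjection r).isSelfAdjoint
  rw [← hsa.star_eq, star_mul, (h.isStarProjection p).isSelfAdjoint.star_eq,
    (h.isStarProjection q).isSelfAdjoint.star_eq]

theorem rangeProj_mul_of_dvd (h : IsNicaRep W) {p q : M} (hpq : p ∣ q) :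
    rangeProj W p * rangeProj W q = rangeProj W q := by
  obtain ⟨t, rfl⟩ := hpq
  have e : rangeProj W (p * t) = W p * (W t * star (W (p * t))) := by
    rw [rangeProj, map_mul, mul_assoc]
  rw [e, ← mul_assoc, h.rangeProj_mul_apply]

theorem map (h : IsNicaRep W) {B F : Type*} [Ring B] [StarRing B] [FunLike F A B]
    [RingHomClass F A B] [StarHomClass F A B] (π : F) :
    IsNicaRep ((π : A →* B).comp W) where
  isometry p := by simp [← map_star, ← map_mul, h.isometry]
  nica p q := by
    rcases h.nica p q with h0 | ⟨p', q', hpq, h1⟩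
    · left; simp [← map_star, ← map_mul, h0]
    · refine Or.inr ⟨p', q', hpq, ?_⟩
      simp [← map_star, ← map_mul, h1]

/-- `Q` is self-adjoint and lies under the range projection of `s` and under the complements of
the range projections of the elements of `C`. -/
structure IsSubordinate (W : M →* A) (Q : A) (s : M) (C : Finset M) : Prop where
  isSelfAdjoint : IsSelfAdjoint Q
  under : rangeProj W s * Q = Q
  avoid : ∀ q ∈ C, rangeProj W q * Q = 0

theorem IsSubordinate.mono (h : IsNicaRep W) {Q : A} {s s' : M} {C C' : Finset M}
    (hQ : IsSubordinate W Q s' C') (hs : s ∣ s') (hC : C ⊆ C') : IsSubordinate W Q s C where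
  isSelfAdjoint := hQ.isSelfAdjoint
  under := by
    rw [← hQ.under, ← mul_assoc, h.rangeProj_mul_of_dvd hs]
  avoid q hq := hQ.avoid q (hC hq)

theorem IsSubordinate.mul_rangeProj (h : IsNicaRep W) {Q : A} {s : M} {C : Finset M}
    (hQ : IsSubordinate W Q s C) : Q * rangeProj W s = Q := by
  have := congrArg star hQ.under
  rwa [star_mul, hQ.isSelfAdjoint.star_eq, (h.isStarProjection s).isSelfAdjoint.star_eq] at this

theorem IsSubordinate.star_mul_eq_zero (h : IsNicaRep W) {Q : A} {s q : M} {C : Finset M}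
    (hQ : IsSubordinate W Q s C) (hq : q ∈ C) : star (W q) * Q = 0 := by
  rw [← h.star_mul_rangeProj, mul_assoc, hQ.avoid q hq, mul_zero]

theorem IsSubordinate.mul_eq_zero (h : IsNicaRep W) {Q : A} {s q : M} {C : Finset M}
    (hQ : IsSubordinate W Q s C) (hq : q ∈ C) : Q * W q = 0 := by
  have := congrArg star (hQ.star_mul_eq_zero h hq)
  rwa [star_mul, star_star, star_zero, hQ.isSelfAdjoint.star_eq] at this

/-- If `s = p a = q b`, compressing `W p (W q)⋆` below `s` reduces it to `(W a)⋆ W b`. -/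
theorem IsSubordinate.compress (h : IsNicaRep W) {Q : A} {p q a b : M} {C : Finset M}
    (hQ : IsSubordinate W Q (p * a) C) (hab : p * a = q * b) :
    Q * (W p * star (W q)) * Q =
      Q * W (p * a) * (star (W a) * W b) * (star (W (p * a)) * Q) := by
  have h1 : star (W (p * a)) * W p = star (W a) := by
    rw [map_mul, star_mul, mul_assoc, h.isometry, mul_one]
  have h2 : star (W q) * W (p * a) = W b := by
    rw [hab, map_mul, ← mul_assoc, h.isometry, one_mul]
  calc Q * (W p * star (W q)) * Q
      = Q * rangeProj W (p * a) * (W p * star (W q)) * (rangeProj W (p * a) * Q) := by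
        rw [hQ.mul_rangeProj h, hQ.under]
    _ = Q * W (p * a) * ((star (W (p * a)) * W p) * (star (W q) * W (p * a))) *
          (star (W (p * a)) * Q) := by simp only [rangeProj, mul_assoc]
    _ = _ := by rw [h1, h2]

/-- If `s` is not a right multiple of any element of `C`, one can pass to a right multiple `s'` of
`s` and a larger set `C'` with the same property such that every subordinate `Q` annihilates the
off-diagonal element `W p (W q)⋆`. The hypothesis `hx` (condition (D2), vacuous if there are no
nontrivial units) is needed only if `b = a x` for a unit `x ≠ 1`, where `s = p a = q b`. -/
theorem exists_refine_pair (h : IsNicaRep W) [IsCancelMul M]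
    (hx : ∀ (s : M) (C : Finset M), (∀ q ∈ C, ¬ q ∣ s) → ∀ x : M, IsUnit x → x ≠ 1 →
      ∃ t, (∀ q ∈ C, ¬ q ∣ s * t) ∧ ∀ a b, t * a ≠ x * (t * b))
    {p q : M} (hpq : p ≠ q) {s : M} {C : Finset M} (hs : ∀ q ∈ C, ¬ q ∣ s) :
    ∃ s' C', s ∣ s' ∧ C ⊆ C' ∧ (∀ q ∈ C', ¬ q ∣ s') ∧
      ∀ Q, IsSubordinate W Q s' C' → Q * (W p * star (W q)) * Q = 0 := by
  classical
  have extend : ∀ m : M, ¬ m ∣ s → (∀ Q, IsSubordinate W Q s (insert m C) →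
      Q * (W p * star (W q)) * Q = 0) → ∃ s' C', s ∣ s' ∧ C ⊆ C' ∧ (∀ q ∈ C', ¬ q ∣ s') ∧
      ∀ Q, IsSubordinate W Q s' C' → Q * (W p * star (W q)) * Q = 0 := fun m hm hQ =>
    ⟨s, insert m C, dvd_rfl, Finset.subset_insert _ _,
      fun r hr => (Finset.mem_insert.1 hr).elim (fun e => e ▸ hm) (hs r), hQ⟩
  have nd : ∀ a', ¬ IsUnit a' → ¬ s * a' ∣ s := by
    rintro a' ha ⟨c, hc⟩
    have h1 : a' * c = 1 := by
      rw [mul_assoc] at hc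
      exact (mul_left_cancel (a := s) (by rw [mul_one]; exact hc)).symm
    have h2 : c * a' = 1 := mul_left_cancel (a := a') (by rw [← mul_assoc, h1, one_mul, mul_one])
    exact ha ⟨⟨a', c, h1, h2⟩, rfl⟩
  by_cases hp : p ∣ s
  swap
  · refine extend p hp fun Q hQ => ?_
    rw [← mul_assoc, hQ.mul_eq_zero h (Finset.mem_insert_self _ _), zero_mul, zero_mul]
  by_cases hq : q ∣ s
  swap
  · refine extend q hq fun Q hQ => ?_
    rw [mul_assoc, mul_assoc, hQ.star_mul_eq_zero h (Finset.mem_insert_self _ _), mul_zero,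
      mul_zero]
  obtain ⟨a, rfl⟩ := hp
  obtain ⟨b, hab⟩ := hq
  rcases h.nica a b with h0 | ⟨a', b', hab', h1⟩
  · refine ⟨p * a, C, dvd_rfl, subset_rfl, hs, fun Q hQ => ?_⟩
    rw [hQ.compress h hab, h0, mul_zero, zero_mul]
  have hne : a' ≠ b' := by
    rintro rfl
    refine hpq (mul_right_cancel (b := a) ?_)
    rw [hab, mul_right_cancel hab']
  have key : ∀ Q C', IsSubordinate W Q (p * a) C' → Q * (W p * star (W q)) * Q =
      (Q * W (p * a * a')) * (star (W (p * a * b')) * Q) := fun Q C' hQ => by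
    rw [hQ.compress h hab, h1, map_mul W (p * a), map_mul W (p * a), star_mul (W (p * a))]
    simp only [mul_assoc]
  by_cases ha' : IsUnit a'
  swap
  · refine extend (p * a * a') (nd a' ha') fun Q hQ => ?_
    rw [key Q _ hQ, hQ.mul_eq_zero h (Finset.mem_insert_self _ _), zero_mul]
  by_cases hb' : IsUnit b'
  swap
  · refine extend (p * a * b') (nd b' hb') fun Q hQ => ?_
    rw [key Q _ hQ, hQ.star_mul_eq_zero h (Finset.mem_insert_self _ _), mul_zero]
  -- Only the case `a a' = b b'` with units `a' ≠ b'` is left: here `x = a' b'⁻¹` applies.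
  obtain ⟨u, rfl⟩ := ha'
  obtain ⟨w, rfl⟩ := hb'
  have hx1 : (↑(u * w⁻¹) : M) ≠ 1 := fun hc => hne (by
    have := Units.val_eq_one.1 hc
    rw [mul_inv_eq_one.1 this])
  obtain ⟨t, ht, htx⟩ := hx (p * a) C hs _ (u * w⁻¹).isUnit hx1
  refine ⟨p * a * t, C, dvd_mul_right _ _, subset_rfl, ht, fun Q hQ => ?_⟩
  have hb : b = a * ↑(u * w⁻¹) := by
    rw [Units.val_mul, ← mul_assoc, hab', mul_assoc, Units.mul_inv, mul_one]
  rw [mul_assoc p] at hQ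
  rw [hQ.compress h (q := q) (b := b * t) (by rw [← mul_assoc, hab, mul_assoc])]
  have hz : star (W (a * t)) * W (b * t) = 0 := by
    have e : star (W (a * t)) * W (b * t) = star (W t) * W (↑(u * w⁻¹) * t) := by
      rw [hb, mul_assoc, map_mul W a, map_mul W a, star_mul, mul_assoc, ← mul_assoc (star (W a)),
        h.isometry, one_mul]
    rw [e]
    rcases h.nica t (↑(u * w⁻¹) * t) with h0 | ⟨c, d, hcd, -⟩
    · exact h0
    · exact absurd (hcd.trans (mul_assoc _ _ _)) (htx c d)
  rw [hz, mul_zero, zero_mul]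

/-- The simultaneous version of `IsNicaRep.exists_refine_pair` for finitely many pairs. -/
theorem exists_refine (h : IsNicaRep W) [IsCancelMul M]
    (hx : ∀ (s : M) (C : Finset M), (∀ q ∈ C, ¬ q ∣ s) → ∀ x : M, IsUnit x → x ≠ 1 →
      ∃ t, (∀ q ∈ C, ¬ q ∣ s * t) ∧ ∀ a b, t * a ≠ x * (t * b))
    (I : Finset (M × M)) (hI : ∀ i ∈ I, i.1 ≠ i.2) {s : M} {C : Finset M}
    (hs : ∀ q ∈ C, ¬ q ∣ s) :
    ∃ s' C', s ∣ s' ∧ C ⊆ C' ∧ (∀ q ∈ C', ¬ q ∣ s') ∧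
      ∀ Q, IsSubordinate W Q s' C' → ∀ i ∈ I, Q * (W i.1 * star (W i.2)) * Q = 0 := by
  classical
  induction I using Finset.induction_on with
  | empty => exact ⟨s, C, dvd_rfl, subset_rfl, hs, by simp⟩
  | insert j I _ ih =>
    obtain ⟨s₁, C₁, hs₁, hC₁, hn₁, hQ₁⟩ := ih fun i hi => hI i (Finset.mem_insert_of_mem hi)
    obtain ⟨s₂, C₂, hs₂, hC₂, hn₂, hQ₂⟩ :=
      h.exists_refine_pair hx (hI j (Finset.mem_insert_self _ _)) hn₁
    refine ⟨s₂, C₂, hs₁.trans hs₂, hC₁.trans hC₂, hn₂, fun Q hQ i hi => ?_⟩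
    rcases Finset.mem_insert.1 hi with rfl | hi
    · exact hQ₂ Q hQ
    · exact hQ₁ Q (hQ.mono h hs₂ hC₂) i hi

/-- A nonzero projection subordinate to `s` and `C` exists as soon as finitely many range
projections of non-units never cover the unit: if `q` ranges over the elements of `C` having a
common right multiple `s q' = q t` with `s`, conjugate by `W s` a projection avoiding the `q'`. -/
theorem exists_subordinate (h : IsNicaRep W)
    (hP : ∀ F : Finset M, (∀ p ∈ F, ¬ IsUnit p) →
      ∃ P : A, P ≠ 0 ∧ IsStarProjection P ∧ ∀ p ∈ F, rangeProj W p * P = 0)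
    {s : M} {C : Finset M} (hs : ∀ q ∈ C, ¬ q ∣ s) :
    ∃ Q : A, Q ≠ 0 ∧ IsStarProjection Q ∧ IsSubordinate W Q s C := by
  classical
  have hq : ∀ q ∈ C, ∃ F : Finset M, (∀ p ∈ F, ¬ IsUnit p) ∧ ∀ P : A,
      (∀ p ∈ F, rangeProj W p * P = 0) → rangeProj W q * (W s * P) = 0 := by
    intro q hqC
    have e : ∀ P, rangeProj W q * (W s * P) = W q * star (star (W s) * W q) * P := fun P => by
      rw [star_mul, star_star, rangeProj]
      simp only [mul_assoc]
    rcases h.nica s q with h0 | ⟨s', q', hsq, h1⟩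
    · exact ⟨∅, by simp, fun P _ => by rw [e, h0, star_zero, mul_zero, zero_mul]⟩
    · refine ⟨{s'}, ?_, fun P hP => ?_⟩
      · intro p hp hu
        rw [Finset.mem_singleton.1 hp] at hu
        obtain ⟨u, rfl⟩ := hu
        exact hs q hqC ⟨q' * ↑u⁻¹, by rw [← mul_assoc, ← hsq, mul_assoc, Units.mul_inv, mul_one]⟩
      · have h2 : star (W s') * P = 0 := by
          rw [← h.star_mul_rangeProj, mul_assoc, hP s' (Finset.mem_singleton_self _), mul_zero]
        rw [e, h1, star_mul, star_star, mul_assoc, mul_assoc, h2, mul_zero, mul_zero]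
  choose! F hF hF' using hq
  obtain ⟨P, hP0, hP1, hP2⟩ := hP (C.biUnion F) fun p hp => by
    obtain ⟨q, hqC, hpq⟩ := Finset.mem_biUnion.1 hp
    exact hF q hqC p hpq
  have hsa : IsSelfAdjoint (W s * P * star (W s)) := by
    rw [IsSelfAdjoint, star_mul, star_mul, star_star, hP1.isSelfAdjoint.star_eq, mul_assoc]
  refine ⟨W s * P * star (W s), fun h0 => hP0 ?_, ⟨?_, hsa⟩, hsa, ?_, fun q hqC => ?_⟩
  · calc P = star (W s) * W s * P * (star (W s) * W s) := by rw [h.isometry, one_mul, mul_one]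
      _ = star (W s) * (W s * P * star (W s)) * W s := by simp only [mul_assoc]
      _ = 0 := by rw [h0, mul_zero, zero_mul]
  · calc W s * P * star (W s) * (W s * P * star (W s))
        = W s * P * (star (W s) * W s) * P * star (W s) := by simp only [mul_assoc]
      _ = W s * P * star (W s) := by
        rw [h.isometry, mul_one, mul_assoc (W s), hP1.isIdempotentElem.eq]
  · rw [mul_assoc, ← mul_assoc, h.rangeProj_mul_apply]
  · rw [← mul_assoc, hF' q hqC P fun p hp => hP2 p (Finset.mem_biUnion.2 ⟨q, hqC, hp⟩), zero_mul]

end Ring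
end IsNicaRep

/-! ### Comparison of the diagonal expectation with a representation -/

namespace IsNicaRep

/-- The norm of a linear combination of range projections is the modulus of the sum of those
coefficients whose index divides a suitable `s`; the other indices form a finite set `C` no element
of which divides `s`. -/
theorem exists_norm_sum_eq {M A ι : Type*} [Monoid M] [CStarAlgebra A] [Nontrivial A]
    {W : M →* A} (h : IsNicaRep W) (I : Finset ι) (f : ι → M) (d : ι → ℂ) :
    ∃ (s : M) (C : Finset M), (∀ q ∈ C, ¬ q ∣ s) ∧ (∀ i ∈ I, f i ∣ s ∨ f i ∈ C) ∧
      ∀ [DecidablePred fun i => f i ∣ s],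
        ‖∑ i ∈ I, d i • rangeProj W (f i)‖ = ‖∑ i ∈ I with f i ∣ s, d i‖ := by
  classical
  let D := StarAlgebra.adjoin ℂ (Set.range (rangeProj W))
  let e : M → D := fun p => ⟨rangeProj W p, StarAlgebra.subset_adjoin ℂ _ ⟨p, rfl⟩⟩
  obtain ⟨χ, hχ⟩ := exists_character_norm_eq (s := Set.range (rangeProj W))
    (by rintro _ ⟨p, rfl⟩; exact (h.isStarProjection p).isSelfAdjoint)
    (by rintro _ ⟨p, rfl⟩ _ ⟨q, rfl⟩; exact h.commute p q)
    (∑ i ∈ I, d i • e (f i))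
  have h01 : ∀ p, χ (e p) = 0 ∨ χ (e p) = 1 := fun p => by
    have : e p * e p = e p := Subtype.ext (h.isStarProjection p).isIdempotentElem
    have := congrArg χ this
    rw [map_mul] at this
    rcases eq_or_ne (χ (e p)) 0 with h0 | h0
    · exact .inl h0
    · exact .inr (mul_left_cancel₀ h0 (by rw [this, mul_one]))
  have hdvd : ∀ p q, p ∣ q → χ (e q) = 1 → χ (e p) = 1 := fun p q hpq hq => by
    have : e p * e q = e q := Subtype.ext (h.rangeProj_mul_of_dvd hpq)
    have := congrArg χ this
    rwa [map_mul, hq, mul_one] at this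
  -- The indices on which the character takes the value `1` have a common right multiple there.
  have hlcm : ∀ J : Finset ι, (∀ i ∈ J, χ (e (f i)) = 1) →
      ∃ s, χ (e s) = 1 ∧ ∀ i ∈ J, f i ∣ s := by
    intro J
    induction J using Finset.induction_on with
    | empty =>
      refine fun _ => ⟨1, ?_, by simp⟩
      have : e 1 = 1 := Subtype.ext (by simp [e, rangeProj])
      rw [this, map_one]
    | insert j J _ ih =>
      intro hJ
      obtain ⟨s, hs, hsJ⟩ := ih fun i hi => hJ i (Finset.mem_insert_of_mem hi)
      have h1 : χ (e (f j) * e s) = 1 := by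
        rw [map_mul, hJ j (Finset.mem_insert_self _ _), hs, mul_one]
      rcases h.rangeProj_mul (f j) s with h0 | ⟨r, hjr, hsr, hr⟩
      · have : e (f j) * e s = 0 := Subtype.ext h0
        rw [this, map_zero] at h1
        exact absurd h1 zero_ne_one
      · have : e (f j) * e s = e r := Subtype.ext hr
        rw [this] at h1
        refine ⟨r, h1, fun i hi => ?_⟩
        rcases Finset.mem_insert.1 hi with rfl | hi
        · exact hjr
        · exact (hsJ i hi).trans hsr
  obtain ⟨s, hs, hsI⟩ := hlcm (I.filter fun i => χ (e (f i)) = 1)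
    fun i hi => (Finset.mem_filter.1 hi).2
  have hiff : ∀ i ∈ I, f i ∣ s ↔ χ (e (f i)) = 1 := fun i hi =>
    ⟨fun hd => hdvd _ _ hd hs, fun h1 => hsI i (Finset.mem_filter.2 ⟨hi, h1⟩)⟩
  refine ⟨s, (I.filter fun i => ¬ f i ∣ s).image f, ?_, fun i hi => ?_, ?_⟩
  · intro q hq
    obtain ⟨i, hi, rfl⟩ := Finset.mem_image.1 hq
    exact (Finset.mem_filter.1 hi).2
  · by_cases hd : f i ∣ s
    · exact .inl hd
    · exact .inr (Finset.mem_image_of_mem f (Finset.mem_filter.2 ⟨hi, hd⟩))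
  · intro _
    have e1 : ‖∑ i ∈ I, d i • rangeProj W (f i)‖ = ‖∑ i ∈ I, d i • e (f i)‖ := by
      change _ = ‖((∑ i ∈ I, d i • e (f i) : D) : A)‖
      rw [AddSubmonoidClass.coe_finsetSum]
      rfl
    rw [e1, ← hχ, map_sum, Finset.sum_filter]
    congr 1
    refine Finset.sum_congr rfl fun i hi => ?_
    rw [map_smul, smul_eq_mul]
    split_ifs with hd
    · rw [(hiff i hi).1 hd, mul_one]
    · rcases h01 (f i) with h0 | h1
      · rw [h0, mul_zero]
      · exact absurd ((hiff i hi).2 h1) hd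

section CStar

variable {M A B : Type*} [Monoid M] [IsCancelMul M] [CStarAlgebra A] [CStarAlgebra B]
  {W : M →* A}

/-- The diagonal expectation is dominated by `π` on the span of the elements `W p (W q)⋆`: a
subordinate projection `Q` compresses `π a` to a scalar whose modulus is `‖Φ a‖`. -/
theorem norm_diagonal_le (h : IsNicaRep W) (π : A →⋆ₐ[ℂ] B)
    (hx : ∀ (s : M) (C : Finset M), (∀ q ∈ C, ¬ q ∣ s) → ∀ x : M, IsUnit x → x ≠ 1 →
      ∃ t, (∀ q ∈ C, ¬ q ∣ s * t) ∧ ∀ a b, t * a ≠ x * (t * b))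
    (hP : ∀ F : Finset M, (∀ p ∈ F, ¬ IsUnit p) →
      ∃ P : B, P ≠ 0 ∧ IsStarProjection P ∧ ∀ p ∈ F, π (rangeProj W p) * P = 0)
    (Φ : A →ₗ[ℂ] A) (hΦ : ∀ p, Φ (W p * star (W p)) = W p * star (W p))
    (hΦ' : ∀ p q, p ≠ q → Φ (W p * star (W q)) = 0)
    {a : A} (ha : a ∈ Submodule.span ℂ (Set.range fun i : M × M => W i.1 * star (W i.2))) :
    ‖Φ a‖ ≤ ‖π a‖ := by
  classical
  rcases subsingleton_or_nontrivial A with _ | _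
  · rw [Subsingleton.elim (Φ a) 0, norm_zero]
    exact norm_nonneg _
  obtain ⟨c, rfl⟩ := Finsupp.mem_span_range_iff_exists_finsupp.1 ha
  have hπ := h.map π
  have hproj : ∀ p, rangeProj ((π : A →* B).comp W) p = π (rangeProj W p) := fun p => by
    simp [rangeProj, map_star]
  set I := c.support.filter fun i => i.1 = i.2 with hI
  set J := c.support.filter fun i => ¬ i.1 = i.2 with hJ
  have e1 : Φ (c.sum fun i d => d • (W i.1 * star (W i.2))) =
      ∑ i ∈ I, c i • rangeProj W i.1 := by
    rw [Finsupp.sum, map_sum, hI, Finset.sum_filter]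
    refine Finset.sum_congr rfl fun i _ => ?_
    rw [map_smul]
    split_ifs with hi
    · rw [← hi, hΦ, rangeProj]
    · rw [hΦ' _ _ hi, smul_zero]
  obtain ⟨s, C, hs, hIC, hnorm⟩ := h.exists_norm_sum_eq I Prod.fst c
  obtain ⟨s', C', hss', hCC', hs', hoff⟩ :=
    hπ.exists_refine hx J (fun i hi => (Finset.mem_filter.1 hi).2) hs
  obtain ⟨Q, hQ0, hQ1, hQ⟩ := hπ.exists_subordinate
    (fun F hF => by simpa only [hproj] using hP F hF) hs'
  have hQs := hQ.mono hπ hss' hCC'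
  have hQn := norm_eq_one_of_isStarProjection hQ1 hQ0
  have hQQ := hQ1.isIdempotentElem.eq
  have key : Q * π (c.sum fun i d => d • (W i.1 * star (W i.2))) * Q =
      (∑ i ∈ I with i.1 ∣ s, c i) • Q := by
    rw [Finsupp.sum, map_sum, Finset.mul_sum, Finset.sum_mul,
      ← Finset.sum_filter_add_sum_filter_not c.support (fun i => i.1 = i.2), ← hI, ← hJ,
      Finset.sum_eq_zero (s := J), add_zero, Finset.sum_smul,
      Finset.sum_filter (fun i : M × M => i.1 ∣ s)]
    · refine Finset.sum_congr rfl fun i hi => ?_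
      rw [map_smul, mul_smul_comm, smul_mul_assoc, ← (Finset.mem_filter.1 hi).2]
      change c i • (Q * π (rangeProj W i.1) * Q) = _
      rw [← hproj, mul_assoc]
      split_ifs with hd
      · rw [(hQs.mono hπ hd subset_rfl).under, hQQ]
      · rw [hQs.avoid _ ((hIC i hi).resolve_left hd), mul_zero, smul_zero]
    · intro i hi
      rw [map_smul, mul_smul_comm, smul_mul_assoc, map_mul, map_star]
      have := hoff Q hQ i hi
      simp only [MonoidHom.comp_apply, MonoidHom.coe_coe] at this
      rw [this, smul_zero]
  calc ‖Φ (c.sum fun i d => d • (W i.1 * star (W i.2)))‖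
      = ‖(∑ i ∈ I with i.1 ∣ s, c i) • Q‖ := by rw [e1, hnorm, norm_smul, hQn, mul_one]
    _ ≤ ‖Q‖ * ‖π (c.sum fun i d => d • (W i.1 * star (W i.2)))‖ * ‖Q‖ := by
      rw [← key]
      exact (norm_mul_le _ _).trans (mul_le_mul_of_nonneg_right (norm_mul_le _ _) (norm_nonneg _))
    _ = ‖π (c.sum fun i d => d • (W i.1 * star (W i.2)))‖ := by rw [hQn, one_mul, mul_one]

open scoped CStarAlgebra in
/-- The abstract uniqueness theorem: faithfulness of the diagonal expectation forces `π` to be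
injective, provided that finitely many range projections of non-units never cover the unit of
`B`. -/
theorem injective_of_faithful (h : IsNicaRep W) (π : A →⋆ₐ[ℂ] B)
    (hx : ∀ (s : M) (C : Finset M), (∀ q ∈ C, ¬ q ∣ s) → ∀ x : M, IsUnit x → x ≠ 1 →
      ∃ t, (∀ q ∈ C, ¬ q ∣ s * t) ∧ ∀ a b, t * a ≠ x * (t * b))
    (hP : ∀ F : Finset M, (∀ p ∈ F, ¬ IsUnit p) →
      ∃ P : B, P ≠ 0 ∧ IsStarProjection P ∧ ∀ p ∈ F, π (rangeProj W p) * P = 0)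
    (hdense : Dense (Submodule.span ℂ
      (Set.range fun i : M × M => W i.1 * star (W i.2)) : Set A))
    (Φ : A →ₗ[ℂ] A) (hΦ : ∀ p, Φ (W p * star (W p)) = W p * star (W p))
    (hΦ' : ∀ p q, p ≠ q → Φ (W p * star (W q)) = 0)
    (hcontr : ∀ a, ‖Φ a‖ ≤ ‖a‖) (hfaith : IsFaithfulMap Φ) : Function.Injective π := by
  have hcont : Continuous Φ :=
    AddMonoidHomClass.continuous_of_bound Φ 1 fun a => by rw [one_mul]; exact hcontr a
  have hle : ∀ a, ‖Φ a‖ ≤ ‖π a‖ := fun a =>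
    hdense.induction (P := fun a => ‖Φ a‖ ≤ ‖π a‖)
      (fun a ha => h.norm_diagonal_le π hx hP Φ hΦ hΦ' ha)
      (isClosed_le hcont.norm (map_continuous π).norm) a
  refine (injective_iff_map_eq_zero π).2 fun a ha => hfaith a ?_
  rw [← norm_le_zero_iff]
  refine (hle _).trans ?_
  rw [map_mul, ha, mul_zero, norm_zero]

end CStar
end IsNicaRep

/-! ### The left regular representation -/

section Regular

open scoped InnerProduct InnerProductSpace

/-- The Hilbert space `ℓ²(α)`. -/
abbrev EllTwo (α : Type*) : Type _ := lp (fun _ : α => ℂ) 2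

namespace EllTwo

variable {α β : Type*}

open scoped Classical in
/-- The standard basis vectors of `ℓ²(α)`. -/
def basisVec (a : α) : EllTwo α := lp.single 2 a 1

theorem inner_basisVec (a : α) (g : EllTwo α) : ⟪basisVec a, g⟫_ℂ = g a := by
  classical
  rw [basisVec, lp.inner_single_left]
  simp

theorem basisVec_apply_self (a : α) : (basisVec a : EllTwo α) a = 1 := by
  classical
  rw [basisVec, lp.single_apply_self]

theorem basisVec_apply_ne {a b : α} (h : b ≠ a) : (basisVec a : EllTwo α) b = 0 := by
  classical
  rw [basisVec, lp.single_apply_ne _ _ _ h]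

theorem basisVec_ne_zero (a : α) : basisVec a ≠ 0 := fun h => by
  have := basisVec_apply_self a
  rw [h] at this
  simp at this

theorem orthonormal_basisVec {f : α → β} (hf : Function.Injective f) :
    Orthonormal ℂ fun a => basisVec (f a) := by
  classical
  rw [orthonormal_iff_ite]
  intro a b
  rw [inner_basisVec]
  split_ifs with h
  · rw [h, basisVec_apply_self]
  · exact basisVec_apply_ne (hf.ne h)

theorem hom_ext {S T : EllTwo α →L[ℂ] EllTwo β} (h : ∀ a, S (basisVec a) = T (basisVec a)) :
    S = T := by
  classical
  refine lp.ext_continuousLinearMap (by norm_num) fun a => ?_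
  refine ContinuousLinearMap.ext_ring ?_
  simpa [basisVec] using h a

/-- The isometry `ℓ²(α) → ℓ²(β)` induced by an injective map `f`. -/
def push {f : α → β} (hf : Function.Injective f) : EllTwo α →L[ℂ] EllTwo β :=
  ((orthonormal_basisVec hf).orthogonalFamily.linearIsometry).toContinuousLinearMap

theorem push_basisVec {f : α → β} (hf : Function.Injective f) (a : α) :
    push hf (basisVec a) = basisVec (f a) := by
  classical
  rw [push, LinearIsometry.coe_toContinuousLinearMap, basisVec,
    OrthogonalFamily.linearIsometry_apply_single]
  simp

theorem adjoint_push_comp {f : α → β} (hf : Function.Injective f) : (push hf)† ∘L push hf = 1 := by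
  refine (ContinuousLinearMap.norm_map_iff_adjoint_comp_self _).1 fun x => ?_
  exact LinearIsometry.norm_map _ x

theorem adjoint_push_basisVec {f : α → β} (hf : Function.Injective f) (a : α) :
    ((push hf)†) (basisVec (f a)) = basisVec a := by
  rw [← push_basisVec hf]
  exact DFunLike.congr_fun (adjoint_push_comp hf) _

theorem adjoint_push_basisVec_of_notMem {f : α → β} (hf : Function.Injective f) {b : β}
    (hb : b ∉ Set.range f) : ((push hf)†) (basisVec b) = 0 := by
  refine lp.ext (funext fun a => ?_)
  rw [← inner_basisVec, ContinuousLinearMap.adjoint_inner_right, push_basisVec, inner_basisVec,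
    basisVec_apply_ne fun h => hb ⟨a, h⟩]
  rfl

/-- The projection of `ℓ²(α)` onto `ℓ²(X)`. -/
def proj (X : Set α) : EllTwo α →L[ℂ] EllTwo α :=
  push (Subtype.val_injective (p := (· ∈ X))) ∘L (push (Subtype.val_injective (p := (· ∈ X))))†

theorem proj_basisVec_of_mem {X : Set α} {a : α} (ha : a ∈ X) :
    proj X (basisVec a) = basisVec a := by
  rw [proj, ContinuousLinearMap.comp_apply]
  have : ((push _)†) (basisVec a) = _ :=
    adjoint_push_basisVec (Subtype.val_injective (p := (· ∈ X))) ⟨a, ha⟩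
  rw [this, push_basisVec]

theorem proj_basisVec_of_notMem {X : Set α} {a : α} (ha : a ∉ X) :
    proj X (basisVec a) = 0 := by
  rw [proj, ContinuousLinearMap.comp_apply, adjoint_push_basisVec_of_notMem, map_zero]
  rwa [Subtype.range_coe]

theorem isSelfAdjoint_proj (X : Set α) : IsSelfAdjoint (proj X) := by
  rw [ContinuousLinearMap.isSelfAdjoint_iff', proj, ContinuousLinearMap.adjoint_comp,
    ContinuousLinearMap.adjoint_adjoint]

theorem proj_mul_proj (X Y : Set α) : proj X * proj Y = proj (X ∩ Y) := by
  refine hom_ext fun a => ?_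
  rw [mul_apply_eq_comp]
  by_cases hY : a ∈ Y
  · rw [proj_basisVec_of_mem hY]
    by_cases hX : a ∈ X
    · rw [proj_basisVec_of_mem hX, proj_basisVec_of_mem (X := X ∩ Y) ⟨hX, hY⟩]
    · rw [proj_basisVec_of_notMem hX, proj_basisVec_of_notMem fun h => hX h.1]
  · rw [proj_basisVec_of_notMem hY, proj_basisVec_of_notMem fun h => hY h.2, map_zero]

theorem push_mul_proj_mul_adjoint {f : α → α} (hf : Function.Injective f) (X : Set α) :
    push hf * proj X * star (push hf) = proj (f '' X) := by
  refine hom_ext fun a => ?_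
  rw [mul_apply_eq_comp, mul_apply_eq_comp,
    ContinuousLinearMap.star_eq_adjoint]
  by_cases ha : a ∈ Set.range f
  · obtain ⟨b, rfl⟩ := ha
    rw [adjoint_push_basisVec]
    by_cases hb : b ∈ X
    · rw [proj_basisVec_of_mem hb, push_basisVec, proj_basisVec_of_mem (Set.mem_image_of_mem f hb)]
    · rw [proj_basisVec_of_notMem hb, map_zero, proj_basisVec_of_notMem]
      rwa [hf.mem_set_image]
  · rw [adjoint_push_basisVec_of_notMem hf ha, map_zero, map_zero, proj_basisVec_of_notMem]
    exact fun h => ha (Set.image_subset_range f X h)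

/-- The left regular representation on `ℓ²(S)` satisfies the defining relations of `C*(S)`. -/
theorem isLiFamily_regular (S : Type*) [Semigroup S] [IsLeftCancelMul S] :
    IsLiFamily (fun p : S => push (mul_right_injective p))
      (fun X : ConstructibleIdeal S => proj X.1) where
  isometry p := adjoint_push_comp _
  projection X := ⟨by rw [IsIdempotentElem, proj_mul_proj, Set.inter_self], isSelfAdjoint_proj _⟩
  mul p q := hom_ext fun a => by
    rw [mul_apply_eq_comp, push_basisVec, push_basisVec, push_basisVec, mul_assoc]
  conj p X := push_mul_proj_mul_adjoint _ _
  empty := hom_ext fun a => proj_basisVec_of_notMem (Set.notMem_empty a)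
  univ := hom_ext fun a => proj_basisVec_of_mem (Set.mem_univ a)
  inter X Y := proj_mul_proj _ _

end EllTwo
end Regular

/-! ### Covers by principal right ideals -/

section Cover

variable {S : Type*} [Semigroup S] [IsCancelMul S]

/-- In a cancellative semigroup an element `p` with `p s = p` forces `s` to be an identity. -/
theorem isIdentity_of_mul_eq_self {p s : S} (h : p * s = p) : IsIdentity s := by
  have h1 : ∀ a, s * a = a := fun a => mul_left_cancel (a := p) (by rw [← mul_assoc, h])
  exact fun a => ⟨h1 a, mul_right_cancel (b := a) (by rw [mul_assoc, h1])⟩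

/-- Finitely many principal right ideals generated by non-units do not cover the semigroup. -/
theorem exists_forall_notMem_principal [Nonempty S] (F : Finset S)
    (hF : ∀ p ∈ F, p ∉ unitSet S) : ∃ s, ∀ p ∈ F, s ∉ principal p := by
  by_cases hi : ∃ i : S, IsIdentity i
  · obtain ⟨i, hi⟩ := hi
    refine ⟨i, fun p hp ⟨t, (ht : p * t = i)⟩ => hF p hp ⟨i, hi, t, ht, ?_⟩⟩
    exact mul_left_cancel (a := p) (by rw [← mul_assoc, ht, (hi p).1, (hi p).2])
  -- Without an identity, `q ∈ pS` is a strict order; a maximal element of `F` does the job.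
  · rcases F.eq_empty_or_nonempty with rfl | hne
    · exact ⟨Classical.arbitrary S, by simp⟩
    let _ : Preorder S :=
      { le := fun q p => q = p ∨ q ∈ principal p
        le_refl := fun _ => .inl rfl
        le_trans := by
          rintro a b c (rfl | ⟨s, rfl⟩) (rfl | ⟨t, rfl⟩)
          · exact .inl rfl
          · exact .inr ⟨t, rfl⟩
          · exact .inr ⟨s, rfl⟩
          · exact .inr ⟨t * s, (mul_assoc _ _ _).symm⟩ }
    obtain ⟨m, hm, hmax⟩ := F.exists_maximal hne
    refine ⟨m, fun p hp hmp => ?_⟩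
    have hpm : p = m ∨ p ∈ principal m := hmax hp (.inr hmp)
    obtain ⟨t, ht⟩ := hmp
    rcases hpm with rfl | ⟨s, hs⟩
    · exact hi ⟨t, isIdentity_of_mul_eq_self ht⟩
    · refine hi ⟨s * t, isIdentity_of_mul_eq_self (p := m) ?_⟩
      change m * s = p at hs
      rw [← mul_assoc, hs]
      exact ht

end Cover

/-! ### Constructible ideals and representations of right LCM semigroups -/

section RightLCM

variable {S : Type*} [Semigroup S]

theorem principal_mul (p q : S) : principal (p * q) = (fun x => p * x) '' principal q := by
  rw [principal, principal, ← Set.range_comp]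
  simp only [Function.comp_def, mul_assoc]

/-- In a right LCM semigroup every constructible right ideal is `∅`, `S` or principal. -/
theorem IsRightLCM.constructible_cases (hLCM : IsRightLCM S) {X : Set S} (hX : IsConstructible X) :
    X = ∅ ∨ X = Set.univ ∨ ∃ p, X = principal p := by
  have := hLCM.1
  induction hX with
  | empty => exact .inl rfl
  | univ => exact .inr (.inl rfl)
  | @mul p X _ ih =>
    rcases ih with rfl | rfl | ⟨q, rfl⟩
    · exact .inl (Set.image_empty _)
    · exact .inr (.inr ⟨p, Set.image_univ⟩)
    · exact .inr (.inr ⟨p * q, (principal_mul p q).symm⟩)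
  | @preimage p X _ ih =>
    rcases ih with rfl | rfl | ⟨q, rfl⟩
    · exact .inl Set.preimage_empty
    · exact .inr (.inl Set.preimage_univ)
    · have e : (fun x => p * x) ⁻¹' principal q =
          (fun x => p * x) ⁻¹' (principal p ∩ principal q) := by
        rw [Set.preimage_inter, principal, principal, Set.preimage_range, Set.univ_inter]
      rcases Set.eq_empty_or_nonempty (principal p ∩ principal q) with h0 | hne
      · left
        rw [e, h0, Set.preimage_empty]
      · obtain ⟨r, hr, rfl | ⟨t, rfl⟩, -⟩ := hLCM.2 p q hne
        · refine .inr (.inl ?_)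
          rw [e, hr, principal, Set.preimage_range]
        · refine .inr (.inr ⟨t, ?_⟩)
          rw [e, hr, principal_mul, Set.preimage_image_eq _ (mul_right_injective p)]

section Family

variable [IsLeftCancelMul S] {A : Type*} [Ring A] [StarRing A] {V : S → A}
  {E : ConstructibleIdeal S → A}

theorem IsLiFamily.mul_star (h : IsLiFamily V E) (p : S) :
    V p * star (V p) = E (.principal p) := by
  have e : ConstructibleIdeal.principal p = ConstructibleIdeal.univ.mul p :=
    Subtype.ext Set.image_univ.symm
  rw [e, ← h.conj, h.univ, mul_one]

theorem IsLiFamily.star_mul_inter (h : IsLiFamily V E) (p q : S) :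
    star (V p) * V q =
      star (V p) * E ((ConstructibleIdeal.principal p).inter (.principal q)) * V q := by
  rw [← h.inter, ← h.mul_star, ← h.mul_star]
  calc star (V p) * V q = (star (V p) * V p) * star (V p) * (V q * (star (V q) * V q)) := by
        rw [h.isometry, h.isometry, one_mul, mul_one]
    _ = _ := by simp only [mul_assoc]

variable {M : Type*} [Monoid M] {j : S →ₙ* M} {W : M →* A}

/-- A family satisfying the defining relations of `C*(S)` yields a Nica covariant representation
of any monoid `M` whose elements are `1` and the images of the elements of `S`. -/
theorem IsLiFamily.isNicaRep (h : IsLiFamily V E) (hLCM : IsRightLCM S)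
    (hj : ∀ m, m = 1 ∨ ∃ s, j s = m) (hW : ∀ s, W (j s) = V s) : IsNicaRep W where
  isometry m := by
    rcases hj m with rfl | ⟨s, rfl⟩
    · rw [map_one, star_one, one_mul]
    · rw [hW, h.isometry]
  nica m n := by
    rcases hj m with rfl | ⟨p, rfl⟩
    · exact .inr ⟨n, 1, by rw [one_mul, mul_one], by simp⟩
    rcases hj n with rfl | ⟨q, rfl⟩
    · exact .inr ⟨1, j p, by rw [one_mul, mul_one], by simp⟩
    rw [hW, hW, h.star_mul_inter]
    rcases Set.eq_empty_or_nonempty (principal p ∩ principal q) with h0 | hne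
    · left
      have e : (ConstructibleIdeal.principal p).inter (.principal q) = .empty := Subtype.ext h0
      rw [e, h.empty, mul_zero, zero_mul]
    · obtain ⟨r, hr, hp, hq⟩ := hLCM.2 p q hne
      have e : (ConstructibleIdeal.principal p).inter (.principal q) = .principal r :=
        Subtype.ext hr
      have hex : ∀ {p : S}, r ∈ insert p (principal p) → ∃ m, j r = j p * m := by
        rintro p (rfl | ⟨t, rfl⟩)
        · exact ⟨1, (mul_one _).symm⟩
        · exact ⟨j t, map_mul j p t⟩
      obtain ⟨p', hp'⟩ := hex hp
      obtain ⟨q', hq'⟩ := hex hq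
      refine .inr ⟨p', q', hp' ▸ hq', ?_⟩
      have h1 : star (V p) * V r = W p' := by
        rw [← hW, ← hW r, hp', map_mul, ← mul_assoc, hW, h.isometry, one_mul]
      have h2 : star (V r) * V q = star (W q') := by
        rw [← star_star (V q), ← star_mul, ← hW, ← hW r, hq', map_mul, ← mul_assoc, hW,
          h.isometry, one_mul]
      rw [e, ← h.mul_star, ← mul_assoc, mul_assoc, h1, h2]

theorem IsLiFamily.pairwise_commute (h : IsLiFamily V E) (F : Finset S) :
    (F : Set S).Pairwise (Function.onFun Commute fun p => 1 - E (.principal p)) :=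
  fun p _ q _ _ => h.commute p q

/-- The product of the commuting projections `1 - E_{pS}`, `p ∈ F`. -/
def IsLiFamily.complProd (h : IsLiFamily V E) (F : Finset S) : A :=
  F.noncommProd (fun p => 1 - E (.principal p)) (h.pairwise_commute F)

theorem IsLiFamily.isStarProjection_complProd (h : IsLiFamily V E) (F : Finset S) :
    IsStarProjection (h.complProd F) := by
  classical
  induction F using Finset.induction_on with
  | empty => rw [complProd, Finset.noncommProd_empty]; exact .one A
  | insert p F hp ih =>
    rw [complProd, Finset.noncommProd_insert_of_notMem _ _ _ _ hp]
    exact (h.projection _).one_sub.mul ih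
      (Finset.noncommProd_commute _ _ _ _ fun q _ => h.commute p q)

theorem IsLiFamily.mul_complProd (h : IsLiFamily V E) {F : Finset S} {p : S} (hp : p ∈ F) :
    E (.principal p) * h.complProd F = 0 := by
  classical
  rw [complProd, ← Finset.mul_noncommProd_erase F hp, ← mul_assoc, mul_sub, mul_one,
    (h.projection _).isIdempotentElem.eq, sub_self, zero_mul]

end Family

namespace SemigroupCStar

variable [IsLeftCancelMul S] {M : Type*} [Monoid M] {j : S →ₙ* M} {W : M →* SemigroupCStar S}

/-- The elements `W p (W q)⋆` span a dense subspace of `C*(S)`, since their span is stable under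
left multiplication by the generators and their adjoints. -/
theorem dense_span_mul_star (hLCM : IsRightLCM S) (hj : ∀ m, m = 1 ∨ ∃ s, j s = m)
    (hW : ∀ s, W (j s) = v s) :
    Dense (Submodule.span ℂ
      (Set.range fun i : M × M => W i.1 * star (W i.2)) : Set (SemigroupCStar S)) := by
  set N := Submodule.span ℂ (Set.range fun i : M × M => W i.1 * star (W i.2)) with hN
  have hF := isLiFamily S
  have h := hF.isNicaRep hLCM hj hW
  have mem : ∀ p q, W p * star (W q) ∈ N := fun p q => Submodule.subset_span ⟨(p, q), rfl⟩
  have stable : ∀ x : SemigroupCStar S, (∀ p q, x * (W p * star (W q)) ∈ N) →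
      ∀ n ∈ N, x * n ∈ N := by
    intro x hx n hn
    induction hn using Submodule.span_induction with
    | mem _ hi => obtain ⟨i, rfl⟩ := hi; exact hx _ _
    | zero => rw [mul_zero]; exact N.zero_mem
    | add a b _ _ ha hb => rw [mul_add]; exact N.add_mem ha hb
    | smul c a _ ha => rw [mul_smul_comm]; exact N.smul_mem c ha
  have hv : ∀ p, ∀ n ∈ N, v p * n ∈ N := fun p => stable _ fun q r => by
    rw [← hW, ← mul_assoc, ← map_mul]
    exact mem _ _
  have hvs : ∀ p, ∀ n ∈ N, star (v p) * n ∈ N := fun p => stable _ fun q r => by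
    rw [← hW, ← mul_assoc]
    rcases h.nica (j p) q with h0 | ⟨p', q', -, h1⟩
    · rw [h0, zero_mul]
      exact N.zero_mem
    · rw [h1, mul_assoc, ← star_mul, ← map_mul]
      exact mem _ _
  have he : ∀ X, ∀ n ∈ N, e X * n ∈ N := by
    intro X n hn
    rcases hLCM.constructible_cases X.2 with h0 | h0 | ⟨p, h0⟩
    · have : X = .empty := Subtype.ext h0
      rw [this, hF.empty, zero_mul]
      exact N.zero_mem
    · have : X = .univ := Subtype.ext h0
      rwa [this, hF.univ, one_mul]
    · have : X = .principal p := Subtype.ext h0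
      rw [this, ← hF.mul_star, mul_assoc]
      exact hv p _ (hvs p n hn)
  have hword : ∀ w : StarWord (S ⊕ ConstructibleIdeal S),
      (ofPre (FreeStarAlg.word w) : SemigroupCStar S) ∈ N := by
    intro w
    induction w using FreeMonoid.inductionOn' with
    | one =>
      rw [map_one FreeStarAlg.word]
      have e1 : (ofPre 1 : SemigroupCStar S) = W 1 * star (W 1) := by simp
      exact e1 ▸ mem 1 1
    | of_mul y w ih =>
      have e1 : (ofPre (FreeStarAlg.word (FreeMonoid.of y * w)) : SemigroupCStar S) =
          ofPre (FreeStarAlg.word (FreeMonoid.of y)) * ofPre (FreeStarAlg.word w) := by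
        rw [map_mul FreeStarAlg.word]
        exact map_mul ofPre _ _
      rw [e1]
      obtain ⟨x, b⟩ := y
      cases b
      · obtain p | X := x
        · exact hv p _ ih
        · exact he X _ ih
      · have e2 : (ofPre (FreeStarAlg.word (FreeMonoid.of (x, true))) : SemigroupCStar S) =
            star (ofPre (FreeStarAlg.gen x)) := by
          refine Eq.trans (congrArg ofPre (Eq.symm ?_)) (star_ofPre _).symm
          refine (FreeStarAlg.star_word _).trans ?_
          simp [StarWord.adj]
        rw [e2]
        obtain p | X := x
        · exact hvs p _ ih
        · change star (e X) * _ ∈ N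
          rw [(hF.projection X).isSelfAdjoint.star_eq]
          exact he X _ ih
  intro a
  refine induction (P := fun a => a ∈ closure (N : Set (SemigroupCStar S))) isClosed_closure
    (fun a => subset_closure ?_) a
  refine FreeStarAlg.induction (P := fun a => (ofPre a : SemigroupCStar S) ∈ N) (fun c w => ?_)
    (fun a b ha hb => ?_) a
  · exact (ofPre_smul (S := S) c (FreeStarAlg.word w)).symm ▸ N.smul_mem c (hword w)
  · exact (map_add ofPre a b).symm ▸ N.add_mem ha hb

variable {B : Type*} [CStarAlgebra B] {V : S → B} {E : ConstructibleIdeal S → B}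

theorem map_complProd (h : IsLiFamily V E) (F : Finset S) :
    lift h ((isLiFamily S).complProd F) = h.complProd F := by
  rw [IsLiFamily.complProd, IsLiFamily.complProd, Finset.map_noncommProd]
  refine Finset.noncommProd_congr rfl (fun p _ => ?_) _
  rw [map_sub, map_one, lift_e]

/-- The nontrivial implication, for a cancellative monoid `M` consisting of `1` and a copy of `S`:
either `S` itself, if it has an identity, or its unitisation. -/
theorem injective_lift [IsCancelMul M] (hLCM : IsRightLCM S) (hj : ∀ m, m = 1 ∨ ∃ s, j s = m)
    (hjinj : Function.Injective j) (hunit : ∀ s ∈ unitSet S, IsUnit (j s))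
    (hW : ∀ s, W (j s) = v s)
    (hx : ∀ (s : M) (C : Finset M), (∀ q ∈ C, ¬ q ∣ s) → ∀ x : M, IsUnit x → x ≠ 1 →
      ∃ t, (∀ q ∈ C, ¬ q ∣ s * t) ∧ ∀ a b, t * a ≠ x * (t * b))
    (Φ : SemigroupCStar S →ₗ[ℂ] SemigroupCStar S)
    (hΦ : ∀ p, Φ (W p * star (W p)) = W p * star (W p))
    (hΦ' : ∀ p q, p ≠ q → Φ (W p * star (W q)) = 0)
    (hcontr : ∀ a, ‖Φ a‖ ≤ ‖a‖) (hfaith : IsFaithfulMap Φ) (h : IsLiFamily V E)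
    (hprod : ∀ F : Finset S, (∀ p ∈ F, p ∉ unitSet S) → h.complProd F ≠ 0) :
    Function.Injective (lift h) := by
  refine ((isLiFamily S).isNicaRep hLCM hj hW).injective_of_faithful (lift h) hx ?_
    (dense_span_mul_star hLCM hj hW) Φ hΦ hΦ' hcontr hfaith
  intro F hF
  refine ⟨_, hprod (F.preimage j hjinj.injOn) fun p hp hpu =>
    hF _ (Finset.mem_preimage.1 hp) (hunit p hpu), h.isStarProjection_complProd _,
    fun m hm => ?_⟩
  rcases hj m with rfl | ⟨s, rfl⟩
  · exact absurd isUnit_one (hF 1 hm)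
  · rw [rangeProj, hW, (isLiFamily S).mul_star, lift_e]
    exact h.mul_complProd (Finset.mem_preimage.2 hm)

end SemigroupCStar

end RightLCM

/-! ### Semigroups with and without identity -/

theorem SemigroupCStar.v_one {S : Type*} [Monoid S] [IsLeftCancelMul S] :
    SemigroupCStar.v (1 : S) = 1 := by
  have h := isLiFamily S
  calc v (1 : S) = star (v 1) * v 1 * v 1 := by rw [h.isometry, one_mul]
    _ = 1 := by rw [mul_assoc, h.mul, mul_one, h.isometry]

theorem isIdentity_iff {S : Type*} [Monoid S] {x : S} : IsIdentity x ↔ x = 1 :=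
  ⟨fun h => by rw [← (h 1).1, mul_one], by rintro rfl a; exact ⟨one_mul a, mul_one a⟩⟩

theorem mem_unitSet_iff {S : Type*} [Monoid S] {x : S} : x ∈ unitSet S ↔ IsUnit x := by
  constructor
  · rintro ⟨i, hi, y, h1, h2⟩
    obtain rfl := isIdentity_iff.1 hi
    exact ⟨⟨x, y, h1, h2⟩, rfl⟩
  · rintro ⟨u, rfl⟩
    exact ⟨1, isIdentity_iff.2 rfl, ↑u⁻¹, u.mul_inv, u.inv_mul⟩

theorem mem_principal_iff_dvd {S : Type*} [Semigroup S] {p s : S} : s ∈ principal p ↔ p ∣ s :=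
  ⟨fun ⟨t, ht⟩ => ⟨t, ht.symm⟩, fun ⟨t, ht⟩ => ⟨t, ht.symm⟩⟩

/-- The form in which condition (D2) enters the argument, with `s₀ = s₁ = s`. -/
theorem ConditionD2.exists_mul {S : Type*} [Monoid S] (h : ConditionD2 S) {s : S} {C : Finset S}
    (hs : ∀ q ∈ C, ¬ q ∣ s) {x : S} (hx : IsUnit x) (hx1 : x ≠ 1) :
    ∃ t, (∀ q ∈ C, ¬ q ∣ s * t) ∧ ∀ a b, t * a ≠ x * (t * b) := by
  obtain ⟨_, ⟨t, rfl⟩, ⟨y, hy, hyC⟩, hdisj⟩ := h s s ⟨1, mul_one s⟩ C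
    ⟨s, ⟨1, mul_one s⟩, by simpa [mem_principal_iff_dvd] using hs⟩ x (mem_unitSet_iff.2 hx)
    (fun hi => hx1 (isIdentity_iff.1 hi))
  refine ⟨t, fun q hq hd => hyC ?_, fun a b hab => ?_⟩
  · exact Set.mem_biUnion hq
      (mem_principal_iff_dvd.2 (hd.trans (mem_principal_iff_dvd.1 hy)))
  · exact Set.notMem_empty (t * a) (hdisj ▸ ⟨⟨a, mul_assoc _ _ _⟩, t * b, ⟨b, mul_assoc _ _ _⟩,
      hab.symm⟩)

theorem SemigroupCStar.injective_lift_of_monoid {S : Type*} [Monoid S] [IsCancelMul S]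
    (hLCM : IsRightLCM S) (hΦ : HasFaithfulDiagonalExpectation S)
    (hS : (unitSet S).Subsingleton ∨ ((unitSet S).Nontrivial ∧ ConditionD2 S))
    {B : Type*} [CStarAlgebra B] {V : S → B} {E : ConstructibleIdeal S → B}
    (h : IsLiFamily V E)
    (hprod : ∀ F : Finset S, (∀ p ∈ F, p ∉ unitSet S) → h.complProd F ≠ 0) :
    Function.Injective (lift h) := by
  obtain ⟨Φ, hd, hc, hf⟩ := hΦ
  let W : S →* SemigroupCStar S :=
    { toFun := v, map_one' := v_one, map_mul' := fun p q => ((isLiFamily S).mul p q).symm }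
  refine injective_lift (j := MulHom.id S) (W := W) hLCM (fun m => .inr ⟨m, rfl⟩)
    (fun _ _ hab => hab) (fun s hs => mem_unitSet_iff.1 hs) (fun _ => rfl) ?_ Φ hd.map_same
    hd.map_ne hc.norm_le hf h hprod
  intro s C hs x hx hx1
  rcases hS with hS | ⟨-, hD⟩
  · exact absurd (hS (mem_unitSet_iff.2 hx) (mem_unitSet_iff.2 isUnit_one)) hx1
  · exact hD.exists_mul hs hx hx1

section WithOne

variable {S : Type*} [Semigroup S]

theorem WithOne.isCancelMul_of_not_exists_isIdentity [IsCancelMul S]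
    (hS : ¬ ∃ i : S, IsIdentity i) : IsCancelMul (WithOne S) := by
  have hr : ∀ p s : S, p * s ≠ p := fun p s h => hS ⟨s, isIdentity_of_mul_eq_self h⟩
  have hl : ∀ p s : S, s * p ≠ p := fun p s h => by
    refine hr s s (mul_right_cancel (b := p) ?_)
    rw [mul_assoc, h, h]
  refine { mul_left_cancel := fun a b c hbc => ?_, mul_right_cancel := fun a b c hbc => ?_ }
  · induction a with
    | one => simpa using hbc
    | coe a =>
      induction b with
      | one =>
        induction c with
        | one => rfl
        | coe c => exact absurd (WithOne.coe_inj.1 hbc).symm (hr _ _)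
      | coe b =>
        induction c with
        | one => exact absurd (WithOne.coe_inj.1 hbc) (hr _ _)
        | coe c => exact congrArg _ (mul_left_cancel (WithOne.coe_inj.1 hbc))
  · induction a with
    | one => simpa using hbc
    | coe a =>
      induction b with
      | one =>
        induction c with
        | one => rfl
        | coe c => exact absurd (WithOne.coe_inj.1 hbc).symm (hl _ _)
      | coe b =>
        induction c with
        | one => exact absurd (WithOne.coe_inj.1 hbc) (hl _ _)
        | coe c => exact congrArg _ (mul_right_cancel (WithOne.coe_inj.1 hbc))

theorem WithOne.eq_one_of_isUnit {x : WithOne S} (hx : IsUnit x) : x = 1 := by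
  obtain ⟨⟨x, y, hxy, -⟩, rfl⟩ := hx
  induction x with
  | one => rfl
  | coe a =>
    induction y with
    | one => simp at hxy
    | coe b => exact absurd hxy (by rw [← WithOne.coe_mul]; exact WithOne.coe_ne_one)

theorem SemigroupCStar.injective_lift_of_not_exists_isIdentity [IsCancelMul S]
    (hS : ¬ ∃ i : S, IsIdentity i)
    (hLCM : IsRightLCM S) (hΦ : HasFaithfulDiagonalExpectation S)
    {B : Type*} [CStarAlgebra B] {V : S → B} {E : ConstructibleIdeal S → B}
    (h : IsLiFamily V E)
    (hprod : ∀ F : Finset S, (∀ p ∈ F, p ∉ unitSet S) → h.complProd F ≠ 0) :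
    Function.Injective (lift h) := by
  obtain ⟨Φ, hd, hc, hf⟩ := hΦ
  have := WithOne.isCancelMul_of_not_exists_isIdentity hS
  let v' : S →ₙ* SemigroupCStar S :=
    { toFun := v, map_mul' := fun p q => ((isLiFamily S).mul p q).symm }
  have hW : ∀ s : S, WithOne.lift v' s = v s := fun s => WithOne.lift_coe v' s
  refine injective_lift (j := WithOne.coeMulHom) (W := WithOne.lift v') hLCM (fun m => ?_)
    WithOne.coe_injective (fun s ⟨i, hi, _⟩ => absurd ⟨i, hi⟩ hS) hW
    (fun s C _ x hx hx1 => absurd (WithOne.eq_one_of_isUnit hx) hx1) Φ (fun p => ?_)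
    (fun p q hpq => ?_) hc.norm_le hf h hprod
  · induction m with
    | one => exact .inl rfl
    | coe s => exact .inr ⟨s, rfl⟩
  · induction p with
    | one => simpa using hd.map_one hS
    | coe s => rw [hW]; exact hd.map_same s
  · induction p with
    | one =>
      induction q with
      | one => exact absurd rfl hpq
      | coe t => rw [hW, map_one, one_mul]; exact hd.map_star_v hS t
    | coe s =>
      induction q with
      | one => rw [hW, map_one, star_one, mul_one]; exact hd.map_v hS s
      | coe t => rw [hW, hW]; exact hd.map_ne s t fun hst => hpq (congrArg _ hst)

end WithOne

/-- The products of the complements of finitely many range projections of non-units do not vanish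
in `C*(S)`, because they do not vanish in the left regular representation. -/
theorem SemigroupCStar.complProd_ne_zero {S : Type*} [Semigroup S] [Nonempty S] [IsCancelMul S]
    {F : Finset S} (hF : ∀ p ∈ F, p ∉ unitSet S) : (isLiFamily S).complProd F ≠ 0 := by
  obtain ⟨s, hs⟩ := exists_forall_notMem_principal F hF
  have hR := EllTwo.isLiFamily_regular S
  intro h0
  have fix : hR.complProd F (EllTwo.basisVec s) = EllTwo.basisVec s := by
    refine Finset.noncommProd_induction F _ _
      (fun T : EllTwo S →L[ℂ] EllTwo S => T (EllTwo.basisVec s) = EllTwo.basisVec s)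
      (fun T U hT hU => by rw [mul_apply_eq_comp, hU, hT]) rfl fun p hp => ?_
    change EllTwo.basisVec s - EllTwo.proj (principal p) (EllTwo.basisVec s) = _
    rw [EllTwo.proj_basisVec_of_notMem (hs p hp), sub_zero]
  rw [← map_complProd, h0, map_zero] at fix
  exact EllTwo.basisVec_ne_zero s fix.symm

end

/-- Uniqueness theorem for `C*(S)` using the diagonal. -/
theorem mainTheorem1 {S : Type*} [Semigroup S] [Nonempty S] [IsCancelMul S]
    (hLCM : IsRightLCM S) (hΦ : HasFaithfulDiagonalExpectation S)
    (hS : (unitSet S).Subsingleton ∨ ((unitSet S).Nontrivial ∧ ConditionD2 S))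
    {B : Type*} [CStarAlgebra B] (V : S → B) (E : ConstructibleIdeal S → B)
    (h : IsLiFamily V E) :
    Function.Injective (SemigroupCStar.lift h) ↔
      ∀ F : Finset S, (∀ p ∈ F, p ∉ unitSet S) →
        F.noncommProd (fun p => 1 - E (.principal p)) (fun p _ q _ _ => h.commute p q) ≠ 0 := by
  constructor
  · intro hinj F hF h0
    refine SemigroupCStar.complProd_ne_zero hF (hinj ?_)
    rw [SemigroupCStar.map_complProd, map_zero]
    exact h0
  · intro hprod
    by_cases hi : ∃ i : S, IsIdentity i
    · obtain ⟨i, hi⟩ := hi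
      let _ : Monoid S :=
        { (inferInstance : Semigroup S) with
          one := i
          one_mul := fun a => (hi a).1
          mul_one := fun a => (hi a).2 }
      exact SemigroupCStar.injective_lift_of_monoid hLCM hΦ hS h hprod
    · exact SemigroupCStar.injective_lift_of_not_exists_isIdentity hi hLCM hΦ h hprod
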